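/- **Setting.** For a differentiable $\varphi:\mathbb R^n\to\mathbb R$ put $D_\varphi(x,y)=\varphi(x)-\varphi(y)-\langle\nabla\varphi(y),x-y\rangle$. Let $\Phi=F+G$ on $\mathbb R^n$, where $F:\mathbb R^n\to\mathbb R$ is $C^1$, $G:\mathbb R^n\to\mathbb R\cup\{+\infty\}$ is proper, lower semicontinuous and convex, and $\inf\Phi>-\infty$. Let $\psi:\mathbb R^n\to\mathbb R$ be $C^2$ and $\sigma_\psi$-strongly convex ($\sigma_\psi>0$). Assume that $F$ is $L$-smooth relative to $\psi$, i.e. $L>0$ and $|D_F(x,u)|\le L\,D_\psi(x,u)$ for all $x,u$ (equivalently, $L\psi-F$ and $L\psi+F$ are convex), that $\nabla F$ and $\nabla\psi$ are Lipschitz continuous on bounded sets, and that $\psi$ has the triangle scaling property with an exponent $\kappa\in(1,2]$: $D_\psi((1-t)x+ty,(1-t)x+tz)\le t^\kappa D_\psi(y,z)$ for all $x,y,z\in\mathbb R^n$, $t\in[0,1]$. **Algorithm (IBPG).** Let $0<\underline a<\overline a\le 1$, $a_{-1}=a_0=1$, and for all $k\ge0$ let $a_{k+1}\in[\underline a,\overline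 a]$ satisfy $$(a_{k+1}^{1-\kappa}+1)^{1/\kappa}(1-a_{k+1})<\frac{a_k^{1/\kappa-1}}{1-a_k}$$ (no condition if $a_k=1$). Given $x_0,x_{-1}\in\mathbb R^n$ and $z_0=x_0$, iterate, with $\gamma_k=a_k^{\kappa-1}/L$, $$y_k=z_k+a_k(x_k-z_k),\quad x_{k+1}=(\nabla\psi+\gamma_k\partial G)^{-1}(\nabla\psi(y_k)-\gamma_k\nabla F(y_k)),\quad z_{k+1}=x_k+a_k(x_{k+1}-x_k).$$ Put $\Psi_0(x_0,x_{-1})=\Phi(x_0)-\inf\Phi+a_{-1}^{1-\kappa}L\,D_\psi(x_0,x_{-1})\in[0,+\infty]$. For a proper lower semicontinuous function $g$, $\partial g$ is the limiting subdifferential and $\operatorname{crit}g=\{x:0\in\partial g(x)\}$. The function $g$ is a KL function if for each $\bar x\in\operatorname{dom}g$ there are a neighborhood $U$ of $\bar x$, an $\eta>0$ and a concave continuous $\varphi:[0,\eta)\to\mathbb R$ with $\varphi(0)=0$ that is $C^1$ with $\varphi'>0$ on $(0,\eta)$, such that $\varphi'(g(x)-g(\bar x))\operatorname{dist}(0,\partial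 g(x))\ge1$ whenever $x\in U$ and $g(\bar x)<g(x)<g(\bar x)+\eta$. **Theorem.** There is $\nu\in(0,1]$, depending only on the parameters $\kappa,\underline a,\overline a,(a_k)$, such that for all $n,F,G,\psi,\sigma_\psi,L$ as above the following holds. (i) For all sequences generated by IBPG, $\sum_{k\ge0}\|x_k-x_{k-1}\|^2<\infty$ and, for all $k\ge0$, $$\min_{0\le i\le k}\|x_i-x_{i-1}\|^2\le\frac{2(\sigma_\psi\nu L)^{-1}\Psi_0(x_0,x_{-1})}{k+1}.$$ Assume moreover that $\Phi$ and $\psi$ are KL functions and that $a_k\equiv a\in[\underline a,\overline a]$ for all $k$ large enough. (ii) If $(x_k)$ is bounded, then $(x_k)$, $(y_k)$ and $(z_k)$ have finite length and converge to the same point of $\operatorname{crit}\Phi$. (iii) Let $x^\star$ be a global minimizer of $\Phi$. For every $r>0$ there are $u\in(0,r)$ and $\mu>0$ such that, whenever IBPG is started at a point $x_0$ with $\|x_0-x^\star\|\le u$ and $\Phi(x_0)<\Phi(x^\star)+\mu$, all $x_k$ stay in the open ball of radius $r$ around $x^\star$, and $(x_k)$, $(y_k)$, $(z_k)$ converge to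 one and the same global minimizer of $\Phi$, which lies in that ball. In particular, if $x^\star$ is an isolated point of $\operatorname{Argmin}\Phi$, then there are $u,\mu>0$ such that for all such $x_0$ the three sequences converge to $x^\star$ itself. -/

import Mathlib

open Filter Topology Set

noncomputable section

namespace IBPG

/-- The Euclidean space of dimension `n`. -/
abbrev E (n : ℕ) := EuclideanSpace ℝ (Fin n)

variable {n : ℕ}

/-- The Bregman divergence of a differentiable, everywhere finite function. -/
def bregman (φ : E n → ℝ) (x y : E n) : ℝ :=
  φ x - φ y - inner ℝ (gradient φ y) (x - y)

/-- The objective `Φ = F + G`, with values in the extended reals. -/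
def objective (F : E n → ℝ) (G : E n → EReal) (x : E n) : EReal := (F x : EReal) + G x

/-- Proper: never `-∞`, and not identically `+∞`. -/
def Proper (g : E n → EReal) : Prop := (∀ x, g x ≠ ⊥) ∧ ∃ x, g x ≠ ⊤

/-- Convexity of an extended-real-valued function (in `EReal`, `0 * ⊤ = 0`). -/
def ConvexEReal (g : E n → EReal) : Prop :=
  ∀ x y : E n, ∀ s t : ℝ, 0 ≤ s → 0 ≤ t → s + t = 1 →
    g (s • x + t • y) ≤ (s : EReal) * g x + (t : EReal) * g y

/-- The subdifferential of convex analysis. -/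
def convexSubdiff (g : E n → EReal) (x : E n) : Set (E n) :=
  {v | ∀ u : E n, g x + ((inner ℝ v (u - x) : ℝ) : EReal) ≤ g u}

/-- The regular (Fréchet) subdifferential, empty at points where `g` is not finite. -/
def regularSubdiff (g : E n → EReal) (x : E n) : Set (E n) :=
  {v | g x ≠ ⊥ ∧ g x ≠ ⊤ ∧ ∀ ε : ℝ, 0 < ε → ∀ᶠ u in 𝓝 x,
    g x + ((inner ℝ v (u - x) - ε * ‖u - x‖ : ℝ) : EReal) ≤ g u}

/-- The limiting (Mordukhovich) subdifferential, empty at points where `g` is not finite. -/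
def limitingSubdiff (g : E n → EReal) (x : E n) : Set (E n) :=
  {v | g x ≠ ⊥ ∧ g x ≠ ⊤ ∧ ∃ u w : ℕ → E n,
    Tendsto u atTop (𝓝 x) ∧ Tendsto (fun k => g (u k)) atTop (𝓝 (g x)) ∧
    (∀ k, w k ∈ regularSubdiff g (u k)) ∧ Tendsto w atTop (𝓝 v)}

/-- Critical points. -/
def crit (g : E n → EReal) : Set (E n) := {x | (0 : E n) ∈ limitingSubdiff g x}

/-- Global minimizers. -/
def argmin (g : E n → EReal) : Set (E n) := {x | ∀ u, g x ≤ g u}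

/-- The Kurdyka-Łojasiewicz property at the point `p`. The inequality
`φ' (g x - g p) * dist (0, ∂g x) ≥ 1` is written out over the elements of `∂g x`
(the distance to the empty set is `+∞`). -/
def KLAt (g : E n → EReal) (p : E n) : Prop :=
  ∃ U ∈ 𝓝 p, ∃ η : ℝ, 0 < η ∧ ∃ φ : ℝ → ℝ,
    φ 0 = 0 ∧ ConcaveOn ℝ (Ico 0 η) φ ∧ ContinuousOn φ (Ico 0 η) ∧
    ContDiffOn ℝ 1 φ (Ioo 0 η) ∧ (∀ s ∈ Ioo 0 η, 0 < deriv φ s) ∧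
    ∀ x ∈ U, g p < g x → g x < g p + (η : EReal) →
      ∀ v ∈ limitingSubdiff g x, 1 ≤ deriv φ ((g x).toReal - (g p).toReal) * ‖v‖

/-- A KL function: the property holds at each point of the domain. -/
def IsKL (g : E n → EReal) : Prop := ∀ p, g p ≠ ⊤ → KLAt g p

/-- The objective splits into a `C¹` part and a proper, closed, convex part, and is bounded
below. -/
structure PremiseA (F : E n → ℝ) (G : E n → EReal) : Prop where
  smooth : ContDiff ℝ 1 F
  proper : Proper G
  closed : LowerSemicontinuous G
  convex : ConvexEReal G
  bddBelow : ∃ m : ℝ, ∀ x, (m : EReal) ≤ objective F G x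

/-- `F` is `L`-smooth relative to `ψ` (smooth adaptability): both `L ψ - F` and `L ψ + F` are
convex, written with Bregman divergences. -/
def RelSmooth (F ψ : E n → ℝ) (L : ℝ) : Prop :=
  0 < L ∧ ∀ x u, |bregman F x u| ≤ L * bregman ψ x u

/-- Lipschitz continuity on bounded subsets. -/
def LipschitzOnBounded (T : E n → E n) : Prop :=
  ∀ B : Set (E n), Bornology.IsBounded B → ∃ K : NNReal, LipschitzOnWith K T B

/-- The assumptions on the kernel `ψ`. -/
structure PremiseB (F ψ : E n → ℝ) (σ L : ℝ) : Prop where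
  smooth : ContDiff ℝ 2 ψ
  σ_pos : 0 < σ
  strongConvex : StrongConvexOn univ σ ψ
  relSmooth : RelSmooth F ψ L
  lipschitz_gradF : LipschitzOnBounded (gradient F)
  lipschitz_gradψ : LipschitzOnBounded (gradient ψ)

/-- The triangle scaling property with exponent `κ`. -/
def TriangleScaling (ψ : E n → ℝ) (κ : ℝ) : Prop :=
  ∀ x y z : E n, ∀ a ∈ Icc (0 : ℝ) 1,
    bregman ψ ((1 - a) • x + a • y) ((1 - a) • x + a • z) ≤ a ^ κ * bregman ψ y z

/-- The parameters `κ`, `lo`, `hi`, `(a k)` allowed in the algorithm. If `a k = 1`, the right-hand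
side of the last condition is `+∞` and the condition is void. -/
structure Parameters (κ lo hi : ℝ) (a : ℕ → ℝ) : Prop where
  one_lt_κ : 1 < κ
  κ_le_two : κ ≤ 2
  lo_pos : 0 < lo
  lo_lt_hi : lo < hi
  hi_le_one : hi ≤ 1
  a_zero : a 0 = 1
  a_mem : ∀ k, a (k + 1) ∈ Icc lo hi
  a_step : ∀ k, a k < 1 →
    ((a (k + 1)) ^ (1 - κ) + 1) ^ (1 / κ) * (1 - a (k + 1)) < (a k) ^ (1 / κ - 1) / (1 - a k)

/-- The step size `γ_k`, as a function of the inertial parameter. -/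
def stepSize (L κ a : ℝ) : ℝ := a ^ (κ - 1) / L

/-- `(x k)`, `(y k)`, `(z k)`, `k = 0, 1, …`, are generated by the inertial Bregman proximal gradient
algorithm. The field `x_step` says that `x (k + 1)` lies in
`(∇ψ + γ ∂G)⁻¹ (∇ψ (y k) - γ ∇F (y k))`. The additional initial point with index `-1` does not
enter any of these recursions. -/
structure IsIBPG (F : E n → ℝ) (G : E n → EReal) (ψ : E n → ℝ) (L κ : ℝ) (a : ℕ → ℝ)
    (x y z : ℕ → E n) : Prop where
  z_zero : z 0 = x 0
  y_step : ∀ k, y k = z k + a k • (x k - z k)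
  x_step : ∀ k, ∃ s ∈ convexSubdiff G (x (k + 1)),
    gradient ψ (x (k + 1)) + stepSize L κ (a k) • s =
      gradient ψ (y k) - stepSize L κ (a k) • gradient F (y k)
  z_step : ∀ k, z (k + 1) = x k + a k • (x (k + 1) - x k)

/-- The shifted sequence `k ↦ x_{k-1}`, with first term `x_{-1} = xm`. -/
def prev (xm : E n) (x : ℕ → E n) : ℕ → E n
  | 0 => xm
  | k + 1 => x k

/-- The Lyapunov function `Φ x - inf Φ + a ^ (1 - κ) L D_ψ (x, x')`. -/
def lyapunov (F : E n → ℝ) (G : E n → EReal) (ψ : E n → ℝ) (L κ a : ℝ) (x x' : E n) : EReal :=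
  objective F G x - (⨅ u, objective F G u) + ((a ^ (1 - κ) * L * bregman ψ x x' : ℝ) : EReal)

/-- Finite length of a sequence. -/
def FiniteLength (x : ℕ → E n) : Prop := Summable fun k => ‖x (k + 1) - x k‖

/-- The three sequences converge to the common limit `p`. -/
def ConvergeTo (x y z : ℕ → E n) (p : E n) : Prop :=
  Tendsto x atTop (𝓝 p) ∧ Tendsto y atTop (𝓝 p) ∧ Tendsto z atTop (𝓝 p)

end IBPG

end

/-! Triangle scaling on all of `E n` is rigid: letting the scaling parameter tend to 1 makes the
Bregman divergence of `ψ` translation invariant, so `ψ` is a quadratic form plus an affine function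
(`exists_isQuadraticKernel`). Relative smoothness is then smoothness in the Hilbert norm given by
the Hessian `T`, and `gradient F` is globally Lipschitz.

The algorithm becomes a proximal gradient step from the extrapolated point `y k = x k - θ • (x k - x
(k - 1))` with `θ = (1 - a k) * (1 - a (k - 1))`. With `Q w = ⟪T w, w⟫`, `p = a k ^ (1 - κ)`, `w`
the last step and `w'` the new one, a step changes the objective by at most `L / 2 * ((p + 1) θ² Q w
- p Q w' - (p - 1) Q (w' + θ w))`. The parameter condition bounds `(p + 1) θ²` by the previous `p`
when `θ > 0`. It is strict at each index, which need not leave a margin uniform in `k`. The Lyapunov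
coefficient is therefore raised from `a ^ (1 - κ)` to `a ^ (1 - κ) + ν (1 - a)`. The surplus is paid
for by the term with `p - 1`, and a decrease by a fixed `δ > 0` results (`exists_isLyapunovPair`,
`IsIBPG.energy_descent`). Summation gives (i).

For (ii) and (iii) the Kurdyka-Łojasiewicz inequality of the objective is carried over to the energy
(`KLAt.exists_desingularizer`). The finite-length argument `kl_trapping` then confines the iterates
near a cluster point or a global minimizer. -/

namespace IBPG

/-! ### Triangle scaling forces a quadratic kernel -/

section

/-- `ψ` is a strongly convex quadratic function with Hessian `T`. -/
structure IsQuadraticKernel {n : ℕ} (ψ : E n → ℝ) (σ : ℝ) (T : E n →L[ℝ] E n) : Prop where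
  symm : ∀ u v, inner ℝ (T u) v = inner ℝ (T v) u
  bregman_eq : ∀ x y, bregman ψ x y = inner ℝ (T (x - y)) (x - y) / 2
  gradient_sub : ∀ x y, gradient ψ x - gradient ψ y = T (x - y)
  lower : ∀ w, σ * ‖w‖ ^ 2 ≤ inner ℝ (T w) w

variable {n : ℕ} {F ψ : E n → ℝ} {G : E n → EReal} {σ L κ : ℝ}

theorem RelSmooth.bregman_nonneg (h : RelSmooth F ψ L) (x u : E n) : 0 ≤ bregman ψ x u := by
  have h1 := (abs_nonneg _).trans (h.2 x u)
  exact nonneg_of_mul_nonneg_right h1 h.1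

/-- For `t < 1` every base point `q` has the form `(1 - t) • x + t • z`, so triangle scaling
compares the displacement `t • w` at `q` with `w` at `z`. Bounding `t ^ κ` by 1 and letting `t → 1`
gives the claim. As `q` and `z` are arbitrary, equality follows by exchanging them. -/
theorem bregman_translate_le (hB : PremiseB F ψ σ L) (hT : TriangleScaling ψ κ) (hκ : 0 ≤ κ)
    (q z w : E n) : bregman ψ (q + w) q ≤ bregman ψ (z + w) z := by
  have key : ∀ t ∈ Ioo (0 : ℝ) 1, bregman ψ (q + t • w) q ≤ bregman ψ (z + w) z := by
    intro t ht
    have h1t : (1 - t) ≠ 0 := by linarith [ht.2]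
    have h := hT ((1 - t)⁻¹ • (q - t • z)) (z + w) z t ⟨ht.1.le, ht.2.le⟩
    rw [smul_inv_smul₀ h1t, sub_add_cancel, smul_add, ← add_assoc, sub_add_cancel] at h
    refine h.trans ?_
    have h0 := hB.relSmooth.bregman_nonneg (z + w) z
    have h1 : t ^ κ ≤ 1 := Real.rpow_le_one ht.1.le ht.2.le hκ
    nlinarith
  have hc : Continuous fun t : ℝ => bregman ψ (q + t • w) q := by
    have := hB.smooth.continuous
    unfold bregman
    fun_prop
  have ht := (hc.tendsto 1).mono_left (nhdsWithin_le_nhds (s := Iio (1 : ℝ)))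
  simp only [one_smul] at ht
  refine le_of_tendsto ht ?_
  filter_upwards [Ioo_mem_nhdsLT (zero_lt_one' ℝ)] with t h using key t h

theorem bregman_translate (hB : PremiseB F ψ σ L) (hT : TriangleScaling ψ κ) (hκ : 0 ≤ κ)
    (q z w : E n) : bregman ψ (q + w) q = bregman ψ (z + w) z :=
  le_antisymm (bregman_translate_le hB hT hκ q z w) (bregman_translate_le hB hT hκ z q w)

/-- The triangle scaling property on the whole space forces the kernel to be quadratic. -/
theorem exists_isQuadraticKernel (hB : PremiseB F ψ σ L) (hT : TriangleScaling ψ κ)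
    (hκ : 0 ≤ κ) : ∃ T : E n →L[ℝ] E n, IsQuadraticKernel ψ σ T := by
  set f : E n → E n := fun z => gradient ψ z - gradient ψ 0 with hf
  set h : E n → ℝ := fun w => bregman ψ w 0 with hh
  have hnn : ∀ w, 0 ≤ h w := fun w => hB.relSmooth.bregman_nonneg w 0
  have htr : ∀ z w, bregman ψ (z + w) z = h w := fun z w => by
    rw [bregman_translate hB hT hκ z 0 w, zero_add]
  -- Symmetry of the left side in `z` and `w` makes the form `⟪f z, w⟫` symmetric; being linear in
  -- `w`, it is linear in `z` as well.
  have hadd : ∀ z w, h (z + w) = h z + h w + inner ℝ (f z) w := by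
    intro z w
    have h1 := htr z w
    simp only [hh, hf, bregman, sub_zero, add_sub_cancel_left, inner_add_right,
      inner_sub_left] at h1 ⊢
    linarith
  have hsymm : ∀ z w, inner ℝ (f z) w = inner ℝ (f w) z := by
    intro z w
    have h1 := hadd z w
    have h2 := hadd w z
    rw [add_comm w z] at h2
    linarith
  let T₀ : E n →ₗ[ℝ] E n :=
    { toFun := f
      map_add' := fun u v => ext_inner_right ℝ fun w => by
        rw [inner_add_left, hsymm, inner_add_right, hsymm w u, hsymm w v]
      map_smul' := fun c u => ext_inner_right ℝ fun w => by
        rw [RingHom.id_apply, real_inner_smul_left, hsymm, real_inner_smul_right, hsymm w u] }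
  let T := LinearMap.toContinuousLinearMap T₀
  have hTf : ∀ z, T z = f z := fun z => rfl
  -- The remainder `q` is additive and has to vanish. If `q w < 0`, evaluating `h ≥ 0` at `w / (N +
  -- 1)` is contradictory for large `N`, since the quadratic part shrinks faster than `q`. Oddness
  -- turns `q ≥ 0` into `q = 0`.
  let q : E n →+ ℝ := AddMonoidHom.mk' (fun w => h w - inner ℝ (T w) w / 2) fun u v => by
    have h1 := hadd u v
    have h2 := hsymm u v
    rw [← hTf, ← hTf] at h2
    rw [← hTf] at h1
    simp only [map_add, inner_add_left, inner_add_right]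
    linarith
  have hq : ∀ w, q w = h w - inner ℝ (T w) w / 2 := fun w => rfl
  have hqnn : ∀ w, 0 ≤ q w := by
    intro w
    by_contra! hneg
    obtain ⟨N, hN⟩ := exists_nat_gt (inner ℝ (T w) w / (2 * -q w))
    have hN' : (0 : ℝ) < (N : ℝ) + 1 := by positivity
    set u : E n := ((N : ℝ) + 1)⁻¹ • w with hu
    have hw : w = (N + 1) • u := by
      rw [← Nat.cast_smul_eq_nsmul ℝ, hu, Nat.cast_add, Nat.cast_one, smul_inv_smul₀ hN'.ne']
    have h1 : q w = (N + 1) * q u := by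
      conv_lhs => rw [hw]
      rw [map_nsmul, nsmul_eq_mul]; push_cast; ring
    have h2 : inner ℝ (T w) w = ((N : ℝ) + 1) ^ 2 * inner ℝ (T u) u := by
      conv_lhs => rw [hw, ← Nat.cast_smul_eq_nsmul ℝ]
      rw [map_smul, real_inner_smul_left, real_inner_smul_right]; push_cast; ring
    have h3 := hq u
    have h4 := hnn u
    rw [div_lt_iff₀ (by linarith)] at hN
    have h5 : 0 ≤ ((N : ℝ) + 1) ^ 2 * h u := by positivity
    nlinarith
  have hq0 : ∀ w, h w = inner ℝ (T w) w / 2 := by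
    intro w
    have h1 := hqnn w
    have h2 := hqnn (-w)
    rw [map_neg] at h2
    have := hq w
    linarith
  have hbr : ∀ x y, bregman ψ x y = inner ℝ (T (x - y)) (x - y) / 2 := by
    intro x y
    rw [← hq0, ← htr y (x - y), add_sub_cancel]
  refine ⟨T, hsymm, hbr, fun x y => ?_, fun w => ?_⟩
  · rw [map_sub, hTf, hTf]; simp [hf]
  -- Strong convexity at the midpoint 0 of `w` and `-w`: the linear terms cancel in `h w + h (-w)`.
  · have h1 := hB.strongConvex.2 (mem_univ w) (mem_univ (-w)) (by norm_num : (0 : ℝ) ≤ 1 / 2)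
      (by norm_num : (0 : ℝ) ≤ 1 / 2) (by norm_num)
    have h2 := hq0 w
    have h3 := hq0 (-w)
    simp only [hh, bregman, map_neg, inner_neg_left, inner_neg_right, neg_neg, sub_zero] at h2 h3
    have h4 : (1 / 2 : ℝ) • w + (1 / 2 : ℝ) • (-w) = 0 := by simp
    have h5 : ‖w - -w‖ = 2 * ‖w‖ := by
      rw [sub_neg_eq_add, ← two_smul ℝ, norm_smul]; norm_num
    rw [h4, h5] at h1
    simp only [smul_eq_mul] at h1
    nlinarith

end

/-! ### Consequences for the smooth part, the proximal step and subgradients -/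

section

variable {n : ℕ} {F ψ : E n → ℝ} {G : E n → EReal} {σ L κ : ℝ} {T : E n →L[ℝ] E n}

namespace IsQuadraticKernel

theorem nonneg (hT : IsQuadraticKernel ψ σ T) (hσ : 0 ≤ σ) (w : E n) : 0 ≤ inner ℝ (T w) w :=
  (by positivity : 0 ≤ σ * ‖w‖ ^ 2).trans (hT.lower w)

theorem abs_bregman_le (hT : IsQuadraticKernel ψ σ T) (hF : RelSmooth F ψ L) (x u : E n) :
    |bregman F x u| ≤ L / 2 * inner ℝ (T (x - u)) (x - u) := by
  have := hF.2 x u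
  rw [hT.bregman_eq] at this
  linarith

/-- Young's inequality for the quadratic form of the kernel. -/
theorem young (hT : IsQuadraticKernel ψ σ T) (hσ : 0 ≤ σ) {ε : ℝ} (hε : 0 < ε) (θ : ℝ)
    (u w : E n) :
    inner ℝ (T u) u ≤ (1 + ε) * θ ^ 2 * inner ℝ (T w) w +
      (1 + 1 / ε) * inner ℝ (T (u + θ • w)) (u + θ • w) := by
  have h1 := hT.nonneg hσ (u + θ • w + (ε * θ) • w)
  have h2 := hT.symm u w
  set s := u + θ • w with hs
  have hu : u = s - θ • w := by simp [hs]
  have h3 := hT.symm s w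
  rw [hu]
  simp only [map_add, map_sub, map_smul, inner_add_left, inner_add_right, inner_sub_left,
    inner_sub_right, real_inner_smul_left, real_inner_smul_right] at h1 ⊢
  rw [← h3] at h1 ⊢
  have h4 : ε * (1 / ε) = 1 := by field_simp
  refine le_of_mul_le_mul_left ?_ hε
  have h5 : ε * ((1 + ε) * θ ^ 2 * inner ℝ (T w) w + (1 + 1 / ε) * inner ℝ (T s) s) =
    ε * (1 + ε) * θ ^ 2 * inner ℝ (T w) w + (ε + ε * (1 / ε)) * inner ℝ (T s) s := by ring
  rw [h5, h4]
  nlinarith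

theorem inner_le (T : E n →L[ℝ] E n) (w : E n) : inner ℝ (T w) w ≤ ‖T‖ * ‖w‖ ^ 2 := by
  have h1 := real_inner_le_norm (T w) w
  have h2 := T.le_opNorm w
  nlinarith [norm_nonneg w]

/-- Relative smoothness with respect to a quadratic kernel makes the gradient Lipschitz. -/
theorem norm_gradient_sub_le (hT : IsQuadraticKernel ψ σ T) (hF : RelSmooth F ψ L)
    (x u : E n) : ‖gradient F x - gradient F u‖ ≤ 3 * L * ‖T‖ * ‖x - u‖ := by
  have hL := hF.1
  set g := gradient F x - gradient F u with hg
  set d := ‖x - u‖ with hd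
  rcases eq_or_ne x u with rfl | hxu
  · simp [hg, hd]
  have hdpos : 0 < d := norm_pos_iff.2 (sub_ne_zero.2 hxu)
  rcases eq_or_ne g 0 with hg0 | hg0
  · rw [hg0, norm_zero]; positivity
  have hgpos : 0 < ‖g‖ := norm_pos_iff.2 hg0
  -- The three-point identity for `F` at `x - r`, `x`, `u` expresses `⟪g, r⟫ = d * ‖g‖` by three
  -- divergences. They are at most `L / 2 * ‖T‖` times `d ^ 2`, `(2 * d) ^ 2`, `d ^ 2`, whence the
  -- constant 3.
  set r := (d / ‖g‖) • g with hr
  have hrn : ‖r‖ = d := by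
    rw [hr, norm_smul, Real.norm_of_nonneg (by positivity), div_mul_cancel₀ _ hgpos.ne']
  have hgr : inner ℝ g r = d * ‖g‖ := by
    rw [hr, real_inner_smul_right, real_inner_self_eq_norm_sq]; field_simp
  have hA := (abs_le.1 (hT.abs_bregman_le hF (x - r) x)).2
  have hB := (abs_le.1 (hT.abs_bregman_le hF (x - r) u)).1
  have hC := (abs_le.1 (hT.abs_bregman_le hF x u)).2
  have qA := inner_le T (x - r - x)
  have qB := inner_le T (x - r - u)
  have qC := inner_le T (x - u)
  have e1 : x - r - x = -r := by abel
  have e2 : x - r - u = (x - u) - r := by abel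
  have hn : ‖x - u - r‖ ≤ 2 * d := by
    have := norm_sub_le (x - u) r
    rw [hrn] at this; linarith
  rw [e1] at hA qA
  rw [e2] at hB qB
  rw [norm_neg, hrn] at qA
  have qB' : inner ℝ (T (x - u - r)) (x - u - r) ≤ ‖T‖ * (2 * d) ^ 2 := qB.trans (by gcongr)
  unfold bregman at hA hB hC
  rw [e1] at hA
  rw [e2] at hB
  have hgr' : inner ℝ (gradient F x) r - inner ℝ (gradient F u) r = d * ‖g‖ := by
    rw [← inner_sub_left]; exact hgr
  simp only [inner_neg_right, inner_sub_right (gradient F u) (x - u)] at hA hB qA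
  have key : d * ‖g‖ ≤ L / 2 * (‖T‖ * d ^ 2 + ‖T‖ * (2 * d) ^ 2 + ‖T‖ * d ^ 2) := by
    rw [mul_add, mul_add]
    have := mul_le_mul_of_nonneg_left qA (by positivity : 0 ≤ L / 2)
    have := mul_le_mul_of_nonneg_left qB' (by positivity : 0 ≤ L / 2)
    have := mul_le_mul_of_nonneg_left qC (by positivity : 0 ≤ L / 2)
    linarith
  refine le_of_mul_le_mul_left (key.trans (le_of_eq ?_)) hdpos
  ring

end IsQuadraticKernel

theorem Proper.ne_top_of_mem_convexSubdiff (hG : Proper G) {x s : E n}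
    (hs : s ∈ convexSubdiff G x) : G x ≠ ⊤ := by
  obtain ⟨u, hu⟩ := hG.2
  intro h
  have h1 := hs u
  rw [h, EReal.top_add_coe, top_le_iff] at h1
  exact hu h1

theorem objective_eq_coe (hG : Proper G) (x : E n) (hx : G x ≠ ⊤) :
    objective F G x = ((F x + (G x).toReal : ℝ) : EReal) := by
  rw [objective, EReal.coe_add, EReal.coe_toReal hx (hG.1 x)]

theorem objective_ne_top_iff {x : E n} : objective F G x ≠ ⊤ ↔ G x ≠ ⊤ := by
  refine ⟨fun h h' => h ?_, fun h h' => h ?_⟩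
  · rw [objective, h', EReal.coe_add_top]
  · rw [objective] at h'
    induction hg : G x with
    | bot => rw [hg] at h'; simp at h'
    | coe r => rw [hg, ← EReal.coe_add] at h'; exact absurd h' (EReal.coe_ne_top _)
    | top => rfl

theorem eq_of_prox_step (hT : IsQuadraticKernel ψ σ T) (hL : 0 < L) {b : ℝ} (hb : 0 < b)
    {x y s : E n}
    (h : gradient ψ x + stepSize L κ b • s = gradient ψ y - stepSize L κ b • gradient F y) :
    s = (L * b ^ (1 - κ)) • T (y - x) - gradient F y := by
  have hγ : L * b ^ (1 - κ) * stepSize L κ b = 1 := by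
    rw [stepSize, show 1 - κ = -(κ - 1) by ring, Real.rpow_neg hb.le]
    have := Real.rpow_pos_of_pos hb (κ - 1)
    field_simp
  have h1 : stepSize L κ b • s = T (y - x) - stepSize L κ b • gradient F y := by
    rw [← hT.gradient_sub, ← sub_eq_zero]
    rw [← sub_eq_zero] at h
    rw [← h]; abel
  have h2 := congrArg (fun t => (L * b ^ (1 - κ)) • t) h1
  simpa only [smul_sub, smul_smul, hγ, one_smul] using h2

/-- The decrease of the objective in one proximal step from an inertial point. -/
theorem objective_descent (hT : IsQuadraticKernel ψ σ T) (hF : RelSmooth F ψ L) (hG : Proper G)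
    {u w w' s : E n} {θ p : ℝ} (hs : s ∈ convexSubdiff G (u + w')) (hu : G u ≠ ⊤)
    (hsp : s = (L * p) • T (u - θ • w - (u + w')) - gradient F (u - θ • w)) :
    F (u + w') + (G (u + w')).toReal ≤ F u + (G u).toReal + L / 2 * ((p + 1) * θ ^ 2 *
      inner ℝ (T w) w - p * inner ℝ (T w') w' -
        (p - 1) * inner ℝ (T (w' + θ • w)) (w' + θ • w)) := by
  have hx := hG.ne_top_of_mem_convexSubdiff hs
  have h1 := hs u
  rw [← EReal.coe_toReal hx (hG.1 _), ← EReal.coe_toReal hu (hG.1 _), ← EReal.coe_add,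
    EReal.coe_le_coe_iff] at h1
  -- Upper smoothness bound at the new point and lower bound at the old one, both based at the
  -- extrapolated point. No convexity of `F` is needed.
  have hA := (abs_le.1 (hT.abs_bregman_le hF (u + w') (u - θ • w))).2
  have hB := (abs_le.1 (hT.abs_bregman_le hF u (u - θ • w))).1
  have e1 : u - (u + w') = -w' := by abel
  have e2 : u + w' - (u - θ • w) = w' + θ • w := by abel
  have e3 : u - (u - θ • w) = θ • w := by abel
  have e4 : u - θ • w - (u + w') = -(w' + θ • w) := by abel
  unfold bregman at hA hB
  rw [e2] at hA
  rw [e3] at hB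
  rw [e1, hsp, e4] at h1
  have hsy := hT.symm w w'
  simp only [map_add, map_neg, map_smul, inner_add_left, inner_add_right, inner_sub_left,
    inner_neg_left, inner_neg_right, real_inner_smul_left, real_inner_smul_right, smul_neg,
    smul_add] at hA hB h1 ⊢
  rw [hsy] at h1 hA ⊢
  linarith

/-- A proximal subgradient, with a quadratic minorant valid on the whole space. -/
def IsProximalSubgradient (g : E n → EReal) (C : ℝ) (x v : E n) : Prop :=
  ∀ u, g x + ((inner ℝ v (u - x) - C * ‖u - x‖ ^ 2 : ℝ) : EReal) ≤ g u

theorem IsProximalSubgradient.mem_regularSubdiff {g : E n → EReal} {C : ℝ} {x v : E n}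
    (h : IsProximalSubgradient g C x v) (h1 : g x ≠ ⊥) (h2 : g x ≠ ⊤) :
    v ∈ regularSubdiff g x := by
  refine ⟨h1, h2, fun ε hε => ?_⟩
  have hc : Tendsto (fun u : E n => C * ‖u - x‖) (𝓝 x) (𝓝 (C * ‖x - x‖)) :=
    (by fun_prop : Continuous fun u : E n => C * ‖u - x‖).tendsto x
  rw [sub_self, norm_zero, mul_zero] at hc
  filter_upwards [hc.eventually_lt_const hε] with u hu
  refine le_trans (add_le_add_right (EReal.coe_le_coe_iff.2 ?_) _) (h u)
  nlinarith [norm_nonneg (u - x)]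

theorem regularSubdiff_subset_limitingSubdiff {g : E n → EReal} {x v : E n}
    (h : v ∈ regularSubdiff g x) : v ∈ limitingSubdiff g x :=
  ⟨h.1, h.2.1, fun _ => x, fun _ => v, tendsto_const_nhds, tendsto_const_nhds, fun _ => h,
    tendsto_const_nhds⟩

/-- The lower smoothness bound for `F` is added to the subgradient inequality of `G`. The minorant
is global with a uniform constant, so it can later be evaluated at a cluster point of the iterates.
-/
theorem isProximalSubgradient_objective (hT : IsQuadraticKernel ψ σ T) (hF : RelSmooth F ψ L)
    (hG : Proper G) {x s : E n} (hs : s ∈ convexSubdiff G x) :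
    IsProximalSubgradient (objective F G) (L / 2 * ‖T‖) x (s + gradient F x) := by
  intro u
  have hL := hF.1
  have hx := hG.ne_top_of_mem_convexSubdiff hs
  rcases eq_or_ne (G u) ⊤ with hu | hu
  · rw [objective, objective, hu, EReal.coe_add_top]; exact le_top
  have h1 := hs u
  rw [objective_eq_coe hG x hx, objective_eq_coe hG u hu, ← EReal.coe_add, EReal.coe_le_coe_iff]
  rw [← EReal.coe_toReal hx (hG.1 _), ← EReal.coe_toReal hu (hG.1 _), ← EReal.coe_add,
    EReal.coe_le_coe_iff] at h1
  have hA := (abs_le.1 (hT.abs_bregman_le hF u x)).1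
  have hB := mul_le_mul_of_nonneg_left (IsQuadraticKernel.inner_le T (u - x))
    (by positivity : 0 ≤ L / 2)
  unfold bregman at hA
  rw [inner_add_left]
  linarith

end

/-! ### Uniform decrease from the condition on the inertial parameters -/

section

theorem mul_rpow_mul_lt_of_step {κ b c : ℝ} (hκ : 1 < κ) (hb0 : 0 < b) (hb : b ≤ 1)
    (hc0 : 0 < c) (hc : c < 1)
    (h : (b ^ (1 - κ) + 1) ^ (1 / κ) * (1 - b) < c ^ (1 / κ - 1) / (1 - c)) :
    (b ^ (1 - κ) + 1) * ((1 - b) * (1 - c)) ^ κ < c ^ (1 - κ) := by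
  have hκ0 : 0 < κ := by linarith
  have hp : 0 < b ^ (1 - κ) + 1 := by have := Real.rpow_pos_of_pos hb0 (1 - κ); linarith
  have hθ : 0 ≤ (1 - b) * (1 - c) := mul_nonneg (by linarith) (by linarith)
  rw [lt_div_iff₀ (by linarith), mul_assoc] at h
  have h1 := Real.rpow_lt_rpow (mul_nonneg (Real.rpow_nonneg hp.le _) hθ) h hκ0
  rw [Real.mul_rpow (Real.rpow_nonneg hp.le _) hθ, ← Real.rpow_mul hp.le,
    ← Real.rpow_mul hc0.le, one_div_mul_cancel hκ0.ne', Real.rpow_one] at h1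
  convert h1 using 2
  field_simp

/-- Combines `exp u ≥ u + 1` with `log b ≤ b - 1`. It quantifies how much of the term with `p - 1`
is available to pay for `ν (1 - b)`. -/
theorem mul_one_sub_le_rpow_sub_one {κ b : ℝ} (hκ : 1 < κ) (hb0 : 0 < b) :
    (κ - 1) * (1 - b) ≤ b ^ (1 - κ) - 1 := by
  rw [Real.rpow_def_of_pos hb0]
  have h1 := Real.add_one_le_exp (Real.log b * (1 - κ))
  have h2 := Real.log_le_sub_one_of_pos hb0
  nlinarith

/-- Constants `ν` and `δ` for which the Lyapunov coefficient `a ^ (1 - κ) + ν (1 - a)` gives a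
decrease by the factor `δ`, uniformly over the admissible pairs of inertial parameters. -/
structure IsLyapunovPair (κ lo ν δ : ℝ) : Prop where
  nonneg : 0 ≤ ν
  pos : 0 < δ
  le_one : δ ≤ 1
  bounds : ∀ b ∈ Icc lo 1, ∀ c ∈ Icc lo 1,
    (c < 1 → (b ^ (1 - κ) + 1) ^ (1 / κ) * (1 - b) < c ^ (1 / κ - 1) / (1 - c)) →
    ν * (1 - b) * (1 + 1 / lo) ≤ b ^ (1 - κ) - 1 ∧
    (b ^ (1 - κ) + 1) * ((1 - b) * (1 - c)) ^ 2 +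
      ν * (1 - b) * (1 + lo) * ((1 - b) * (1 - c)) ^ 2 + δ ≤ c ^ (1 - κ) + ν * (1 - c)

/-- Write `β = 1 - c`. If `β` is not small, the parameter condition gives a nonstrict bound and the
surplus `ν β` supplies the margin. If `β` is small, so is the extrapolation, and the margin comes
from `c ^ (1 - κ) ≥ 1`. -/
theorem exists_isLyapunovPair {κ lo : ℝ} (hκ : 1 < κ) (hκ2 : κ ≤ 2) (hlo : 0 < lo)
    (hlo1 : lo ≤ 1) : ∃ ν δ : ℝ, IsLyapunovPair κ lo ν δ := by
  set P := lo ^ (1 - κ) with hP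
  have hP0 : 0 < P := Real.rpow_pos_of_pos hlo _
  -- The threshold for `β`, chosen so that `β < t` forces `(p + 1) (α β)² ≤ 1 / 2`. The value of `ν`
  -- makes the first bound exactly `mul_one_sub_le_rpow_sub_one`.
  set t := 1 / (2 * (P + 1)) with ht
  have ht0 : 0 < t := by positivity
  have ht1 : t ≤ 1 := by rw [ht, div_le_one (by positivity)]; linarith
  have hPt : (P + 1) * t = 1 / 2 := by rw [ht]; field_simp
  set ν := (κ - 1) * lo / (1 + lo) with hν
  have hν0 : 0 < ν := div_pos (mul_pos (by linarith) hlo) (by linarith)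
  refine ⟨ν, min (1 / 2) (ν * lo * t), hν0.le, lt_min (by norm_num) (by positivity),
    (min_le_left _ _).trans (by norm_num), fun b hb c hc hstep => ⟨?_, ?_⟩⟩
  · have h1 : ν * (1 - b) * (1 + 1 / lo) = (κ - 1) * (1 - b) := by
      rw [hν]; field_simp; ring
    rw [h1]
    exact mul_one_sub_le_rpow_sub_one hκ (hlo.trans_le hb.1)
  · have hb0 : 0 < b := hlo.trans_le hb.1
    have hc0 : 0 < c := hlo.trans_le hc.1
    have hbP : b ^ (1 - κ) ≤ P := Real.rpow_le_rpow_of_nonpos hlo hb.1 (by linarith)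
    have hp0 : 0 < b ^ (1 - κ) := Real.rpow_pos_of_pos hb0 _
    have hq1 : 1 ≤ c ^ (1 - κ) := Real.one_le_rpow_of_pos_of_le_one_of_nonpos hc0 hc.2 (by linarith)
    set p := b ^ (1 - κ)
    set q := c ^ (1 - κ)
    obtain ⟨α, rfl⟩ : ∃ α, b = 1 - α := ⟨1 - b, by ring⟩
    obtain ⟨β, rfl⟩ : ∃ β, c = 1 - β := ⟨1 - c, by ring⟩
    simp only [sub_sub_cancel] at hstep ⊢
    have hα0 : 0 ≤ α := by linarith [hb.2]
    have hβ0 : 0 ≤ β := by linarith [hc.2]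
    have hα1 : α ≤ 1 - lo := by linarith [hb.1]
    have hβ1 : β ≤ 1 - lo := by linarith [hc.1]
    have hθ1 : α * β ≤ 1 - lo := by nlinarith
    -- The cost of the surplus uses up only the fraction `1 - lo` of the gain `ν β`.
    have hextra : ν * α * (1 + lo) * (α * β) ^ 2 ≤ ν * (β * (1 - lo)) := by
      have h1 : α ^ 2 * (1 + lo) ≤ 1 := by
        have h2 : α ^ 2 * (1 + lo) ≤ (1 - lo) ^ 2 * (1 + lo) := by gcongr
        have h3 := mul_nonneg (sq_nonneg lo) (sub_nonneg.2 hlo1)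
        linarith
      have h3 : ν * α * (1 + lo) * (α * β) ^ 2 = ν * (β * ((α ^ 2 * (1 + lo)) * (α * β))) := by ring
      rw [h3]
      gcongr
      calc α ^ 2 * (1 + lo) * (α * β) ≤ 1 * (1 - lo) := by gcongr
        _ = 1 - lo := one_mul _
    have hδ1 := min_le_left (1 / 2) (ν * lo * t)
    have hδ2 := min_le_right (1 / 2) (ν * lo * t)
    rcases le_or_gt t β with hβt | hβt
    · have hθ : (p + 1) * (α * β) ^ 2 ≤ q := by
        rcases hα0.eq_or_lt with rfl | hα0'
        · simp; linarith
        have hpos : 0 < α * β := mul_pos hα0' (ht0.trans_le hβt)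
        have h1 := mul_rpow_mul_lt_of_step hκ hb0 hb.2 hc0 (by linarith)
          (by simpa only [sub_sub_cancel] using hstep (by linarith))
        simp only [sub_sub_cancel] at h1
        -- Here `κ ≤ 2` enters: the quadratic kernel produces the square, the parameter condition
        -- controls the power `κ`.
        have h2 : (α * β) ^ 2 ≤ (α * β) ^ κ := by
          rw [← Real.rpow_natCast]
          exact Real.rpow_le_rpow_of_exponent_ge hpos (by linarith) (by exact_mod_cast hκ2)
        exact (mul_le_mul_of_nonneg_left h2 (by linarith)).trans h1.le
      have h4 : ν * lo * t ≤ ν * lo * β := by gcongr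
      linarith
    · have hθ : (p + 1) * (α * β) ^ 2 ≤ 1 / 2 := by
        rw [← hPt]
        have h5 : (α * β) ^ 2 ≤ t := by
          have h6 : α * β ≤ t := by nlinarith
          have h7 : 0 ≤ α * β := by positivity
          nlinarith
        gcongr
      have h8 : ν * (β * (1 - lo)) ≤ ν * β := by
        have := mul_nonneg (mul_nonneg hν0.le hβ0) hlo.le
        linarith
      linarith

end

/-! ### Desingularizing functions and trapping -/

section

/-- The properties of a concave desingularizing function `φ` with derivative `φ'` on `(0, η)` that
are used in length estimates. -/
structure IsDesingularizer (η : ℝ) (φ φ' : ℝ → ℝ) : Prop where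
  zero : φ 0 = 0
  tendsto : Tendsto φ (𝓝[≥] 0) (𝓝 0)
  deriv_nonneg : ∀ s ∈ Ioo 0 η, 0 ≤ φ' s
  le : ∀ s ∈ Ioo 0 η, ∀ t ∈ Icc 0 s, φ t + φ' s * (s - t) ≤ φ s

namespace IsDesingularizer

variable {η : ℝ} {φ φ' : ℝ → ℝ}

theorem mono (h : IsDesingularizer η φ φ') {s t : ℝ} (hs : s < η) (ht : 0 ≤ t) (hts : t ≤ s) :
    φ t ≤ φ s := by
  rcases (ht.trans hts).eq_or_lt with h0 | h0
  · obtain rfl : t = s := by linarith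
    exact le_rfl
  · have h1 := h.le s ⟨h0, hs⟩ t ⟨ht, hts⟩
    have h2 := mul_nonneg (h.deriv_nonneg s ⟨h0, hs⟩) (sub_nonneg.2 hts)
    linarith

theorem nonneg (h : IsDesingularizer η φ φ') {s : ℝ} (hs : s < η) (h0 : 0 ≤ s) : 0 ≤ φ s :=
  h.zero.symm.trans_le (h.mono hs le_rfl h0)

theorem exists_small (h : IsDesingularizer η φ φ') (hη : 0 < η) (c M : ℝ) {ρ : ℝ} (hρ : 0 < ρ) :
    ∃ μ, 0 < μ ∧ μ ≤ η ∧ ∀ e, 0 ≤ e → e < μ → 2 * √(e / c) + 2 * M * φ e < ρ := by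
  have h1 : Tendsto (fun e => 2 * √(e / c) + 2 * M * φ e) (𝓝[≥] 0) (𝓝 0) := by
    have h2 : Tendsto (fun e : ℝ => 2 * √(e / c)) (𝓝[≥] 0) (𝓝 (2 * √(0 / c))) :=
      ((by fun_prop : Continuous fun e : ℝ => 2 * √(e / c)).tendsto 0).mono_left
        nhdsWithin_le_nhds
    simpa using h2.add (h.tendsto.const_mul (2 * M))
  obtain ⟨u, hu, hsub⟩ := mem_nhdsGE_iff_exists_Ico_subset.1 (h1.eventually_lt_const hρ)
  exact ⟨min u η, lt_min hu hη, min_le_right _ _,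
    fun e he0 he => hsub ⟨he0, he.trans_le (min_le_left _ _)⟩⟩

end IsDesingularizer

/-- A sequence with sufficient decrease of an energy `e`, for which a Kurdyka-Łojasiewicz
inequality holds in a ball, cannot leave the ball if it starts near the centre with small energy. -/
theorem kl_trapping {V : Type*} [SeminormedAddCommGroup V] {x : ℕ → V} {p : V}
    {d e : ℕ → ℝ} {c C r η : ℝ} {φ φ' : ℝ → ℝ} (hφ : IsDesingularizer η φ φ') (hc : 0 < c)
    (hC : 0 ≤ C) (hd0 : 0 ≤ d 0) (hd : ∀ k, d (k + 1) = ‖x (k + 1) - x k‖) (he : ∀ k, 0 ≤ e k)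
    (hdec : ∀ k, e (k + 1) + c * d k ^ 2 ≤ e k) (heη : e 0 < η)
    (hKL : ∀ k, ‖x (k + 1) - p‖ < r → 0 < e (k + 1) → e (k + 1) < η →
      1 ≤ φ' (e (k + 1)) * (C * (d (k + 1) + d k)))
    (hsmall : ‖x 0 - p‖ + (2 * √(e 0 / c) + 2 * (C / c) * φ (e 0)) < r) :
    (∀ k, ‖x k - p‖ < r) ∧ Summable d ∧ Tendsto e atTop (𝓝 0) := by
  have hdnn : ∀ k, 0 ≤ d k := by
    intro k
    cases k with
    | zero => exact hd0
    | succ k => rw [hd]; exact norm_nonneg _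
  have hanti : Antitone e := antitone_nat_of_succ_le fun k => by
    have := hdec k
    have : 0 ≤ c * d k ^ 2 := by positivity
    linarith
  have he0 : ∀ k, e k ≤ e 0 := fun k => hanti (Nat.zero_le k)
  have heη' : ∀ k, e k < η := fun k => (he0 k).trans_lt heη
  have hdsq : ∀ k, c * d k ^ 2 ≤ e k := fun k => by linarith [hdec k, he (k + 1)]
  have hdle : ∀ k, d k ≤ √(e 0 / c) := by
    intro k
    refine Real.le_sqrt_of_sq_le ?_
    rw [le_div_iff₀ hc, mul_comm]
    exact (hdsq k).trans (he0 k)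
  set M := C / c with hM
  have hM0 : 0 ≤ M := div_nonneg hC hc.le
  have hCM : C = M * c := by rw [hM, div_mul_cancel₀ _ hc.ne']
  -- Concavity and the KL inequality give `d (k + 1) ^ 2 ≤ M * Δ * (d (k + 1) + d k)`. The
  -- arithmetic-geometric mean inequality, weighted with `1 / 4`, lets the steps telescope.
  have hstep : ∀ k, ‖x (k + 1) - p‖ < r →
      3 / 2 * d (k + 1) ≤ d k / 2 + 2 * M * (φ (e (k + 1)) - φ (e (k + 2))) := by
    intro k hk
    have hmono := hφ.mono (heη' (k + 1)) (he (k + 2)) (hanti (Nat.le_succ (k + 1)))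
    rcases (he (k + 1)).eq_or_lt with h0 | h0
    · have h1 : d (k + 1) ^ 2 ≤ 0 := by
        have := hdsq (k + 1)
        rw [← h0] at this
        exact nonpos_of_mul_nonpos_right this hc
      have h2 : d (k + 1) = 0 := by nlinarith [hdnn (k + 1)]
      have := mul_nonneg hM0 (sub_nonneg.2 hmono)
      rw [h2]
      linarith [hdnn k]
    · have hkl := hKL k hk h0 (heη' _)
      have h1 := hφ.le _ ⟨h0, heη' _⟩ _ ⟨he (k + 2), hanti (Nat.le_succ (k + 1))⟩
      have hφ' := hφ.deriv_nonneg _ ⟨h0, heη' (k + 1)⟩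
      set Δ := φ (e (k + 1)) - φ (e (k + 2)) with hΔ
      set S := d (k + 1) + d k with hS
      have hS0 : 0 ≤ S := add_nonneg (hdnn _) (hdnn _)
      have h2 : φ' (e (k + 1)) * (c * d (k + 1) ^ 2) ≤ Δ := by
        have := mul_le_mul_of_nonneg_left (show c * d (k + 1) ^ 2 ≤ e (k + 1) - e (k + 2) by
          linarith [hdec (k + 1)]) hφ'
        linarith
      have h3 : d (k + 1) ^ 2 ≤ M * Δ * S := by
        have h4 := mul_le_mul_of_nonneg_left hkl (by positivity : 0 ≤ c * d (k + 1) ^ 2)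
        have h5 := mul_le_mul_of_nonneg_right h2 (mul_nonneg hC hS0)
        have h6 : c * d (k + 1) ^ 2 ≤ c * (M * Δ * S) := by
          rw [hCM] at h4 h5
          linarith
        exact le_of_mul_le_mul_left h6 hc
      have hMΔ : 0 ≤ M * Δ := mul_nonneg hM0 (sub_nonneg.2 hmono)
      have h7 : d (k + 1) ≤ S / 4 + M * Δ := by
        refine abs_le_of_sq_le_sq' ?_ (by positivity) |>.2
        nlinarith [sq_nonneg (S / 4 - M * Δ)]
      linarith
  have key : ∀ N, ‖x N - p‖ < r ∧ ‖x N - x 0‖ ≤ ∑ k ∈ Finset.range N, d (k + 1) ∧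
      ∑ k ∈ Finset.range N, d (k + 1) + d N / 2 ≤
        d 0 / 2 + 2 * M * (φ (e 1) - φ (e (N + 1))) := by
    intro N
    induction N with
    | zero =>
      refine ⟨?_, by simp, by simp⟩
      have := mul_nonneg (mul_nonneg zero_le_two hM0) (hφ.nonneg heη (he 0))
      linarith [Real.sqrt_nonneg (e 0 / c)]
    | succ N ih =>
      have h1 : ‖x (N + 1) - x 0‖ ≤ ∑ k ∈ Finset.range (N + 1), d (k + 1) := by
        rw [Finset.sum_range_succ, hd N]
        have := norm_sub_le_norm_sub_add_norm_sub (x (N + 1)) (x N) (x 0)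
        linarith [ih.2.1]
      -- `hstep` is not available until `x (N + 1)` is known to be in the ball, so the step `d (N +
      -- 1)` is bounded by `√(e 0 / c)` instead.
      have h2 : ‖x (N + 1) - p‖ < r := by
        have h3 := norm_sub_le_norm_sub_add_norm_sub (x (N + 1)) (x 0) p
        rw [Finset.sum_range_succ] at h1
        have h4 := mul_nonneg hM0 (hφ.nonneg (heη' (N + 1)) (he (N + 1)))
        have h5 := mul_le_mul_of_nonneg_left (hφ.mono heη (he 1) (he0 1)) hM0
        linarith [ih.2.2, hdle 0, hdle (N + 1), hdnn N, hdnn 0]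
      refine ⟨h2, h1, ?_⟩
      rw [Finset.sum_range_succ]
      have := hstep N h2
      linarith [ih.2.2]
  have hsum : Summable d := by
    refine (summable_nat_add_iff 1).1 (summable_of_sum_range_le (c := d 0 / 2 + 2 * M * φ (e 1))
      (fun k => hdnn (k + 1)) fun N => ?_)
    have h4 := mul_nonneg hM0 (hφ.nonneg (heη' (N + 1)) (he (N + 1)))
    linarith [(key N).2.2, hdnn N]
  refine ⟨fun k => (key k).1, hsum, ?_⟩
  have hbdd : BddBelow (range e) := ⟨0, by rintro _ ⟨k, rfl⟩; exact he k⟩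
  have hlim := tendsto_atTop_ciInf hanti hbdd
  set l := ⨅ k, e k
  have hl0 : 0 ≤ l := ge_of_tendsto' hlim he
  rcases hl0.eq_or_lt with h0 | h0
  · rwa [← h0] at hlim
  -- With a positive limit `l`, concavity bounds `φ'` along the sequence by `φ (e 0) / l`. As the
  -- steps tend to 0, the KL inequality fails eventually.
  · exfalso
    have hle : ∀ k, l ≤ e k := fun k => ciInf_le hbdd k
    have hbound : ∀ k, 1 ≤ φ (e 0) / l * (C * (d (k + 1) + d k)) := by
      intro k
      have hpos : 0 < e (k + 1) := h0.trans_le (hle _)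
      have h1 := hφ.le _ ⟨hpos, heη' (k + 1)⟩ 0 ⟨le_rfl, hpos.le⟩
      rw [hφ.zero, zero_add, sub_zero] at h1
      have h2 := hφ.mono heη (he (k + 1)) (he0 _)
      have h3 := hφ.deriv_nonneg _ ⟨hpos, heη' (k + 1)⟩
      have h4 : φ' (e (k + 1)) ≤ φ (e 0) / l := by
        rw [le_div_iff₀ h0]
        exact (mul_le_mul_of_nonneg_left (hle _) h3).trans (h1.trans h2)
      refine (hKL k (key _).1 hpos (heη' _)).trans (mul_le_mul_of_nonneg_right h4 ?_)
      exact mul_nonneg hC (add_nonneg (hdnn _) (hdnn _))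
    have hd_lim := hsum.tendsto_atTop_zero
    have h5 : Tendsto (fun k => φ (e 0) / l * (C * (d (k + 1) + d k))) atTop (𝓝 0) := by
      have := ((((tendsto_add_atTop_iff_nat 1).2 hd_lim).add hd_lim).const_mul C).const_mul
        (φ (e 0) / l)
      simpa using this
    have := ge_of_tendsto' h5 hbound
    linarith

variable {n : ℕ}

/-- The Kurdyka-Łojasiewicz property of `g` passes to energies that exceed `g` by at most a
multiple of the squared step length. -/
theorem KLAt.exists_desingularizer {g : E n → EReal} {p : E n} (h : KLAt g p)
    (hp : g p ≠ ⊥) (hp' : g p ≠ ⊤) :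
    ∃ r > 0, ∃ η > 0, ∃ φ φ' : ℝ → ℝ, IsDesingularizer η φ φ' ∧
      ∀ x v : E n, ∀ e δ D C₀ C₁ : ℝ, ‖x - p‖ < r → v ∈ limitingSubdiff g x → 0 ≤ C₀ → 0 ≤ C₁ →
        0 ≤ D → ‖v‖ ≤ C₀ * D → e = (g x).toReal + δ - (g p).toReal → δ ≤ C₁ ^ 2 / 2 * D ^ 2 →
        0 ≤ δ → 0 < e → e < η → 1 ≤ φ' e * ((C₀ + C₁) * D) := by
  obtain ⟨U, hU, η, hη, φ, hφ0, hconc, hcont, hsm, hpos, hKL⟩ := h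
  obtain ⟨r, hr, hrU⟩ := Metric.mem_nhds_iff.1 hU
  have hdiff : ∀ s ∈ Ioo 0 η, DifferentiableAt ℝ φ s := fun s hs =>
    (hsm.differentiableOn one_ne_zero).differentiableAt (isOpen_Ioo.mem_nhds hs)
  have hantit : AntitoneOn (deriv φ) (Ioo 0 η) :=
    (hconc.subset Ioo_subset_Ico_self (convex_Ioo 0 η)).antitoneOn_deriv hdiff
  have hconc' : ∀ s ∈ Ioo 0 η, ∀ t ∈ Icc 0 s, φ t + deriv φ s * (s - t) ≤ φ s := by
    intro s hs t ht
    rcases ht.2.eq_or_lt with rfl | hts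
    · simp
    have h1 := hconc.deriv_le_slope ⟨ht.1, hts.trans hs.2⟩ ⟨hs.1.le, hs.2⟩ hts (hdiff s hs)
    rw [slope_def_field, le_div_iff₀ (sub_pos.2 hts)] at h1
    linarith
  have hhalf : ∀ s ∈ Ioo 0 η, s / 2 ∈ Ioo 0 η := fun s hs =>
    ⟨by linarith [hs.1], by linarith [hs.1, hs.2]⟩
  -- Either the gap of `g` or the excess `δ` makes up at least half of `e`. The first summand serves
  -- the former case, through monotonicity of `deriv φ`; the square root serves the latter, where
  -- `√e ≤ C₁ * D`.
  refine ⟨r, hr, η, hη, fun s => 2 * φ (s / 2) + 2 * √s, fun s => deriv φ (s / 2) + 1 / √s,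
    ⟨by simp [hφ0], ?_, fun s hs => ?_, fun s hs t ht => ?_⟩, ?_⟩
  · have h1 : Tendsto φ (𝓝[≥] 0) (𝓝 0) := by
      have := hcont 0 ⟨le_rfl, hη⟩
      rw [ContinuousWithinAt, hφ0, nhdsWithin_Ico_eq_nhdsGE hη] at this
      exact this
    have h2 : Tendsto (fun s : ℝ => s / 2) (𝓝[≥] 0) (𝓝[≥] 0) := by
      refine tendsto_nhdsWithin_iff.2 ⟨?_, ?_⟩
      · have := ((by fun_prop : Continuous fun s : ℝ => s / 2).tendsto 0).mono_left
          (nhdsWithin_le_nhds (s := Ici 0))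
        simpa using this
      · filter_upwards [self_mem_nhdsWithin] with s hs
        have : (0 : ℝ) ≤ s := hs
        exact mem_Ici.2 (by linarith)
    have h3 : Tendsto (fun s : ℝ => √s) (𝓝[≥] 0) (𝓝 0) := by
      have := (Real.continuous_sqrt.tendsto 0).mono_left (nhdsWithin_le_nhds (s := Ici 0))
      simpa using this
    simpa using ((h1.comp h2).const_mul 2).add (h3.const_mul 2)
  · have := hpos _ (hhalf s hs)
    positivity
  · have h1 := hconc' _ (hhalf s hs) (t / 2) ⟨by linarith [ht.1], by linarith [ht.2]⟩
    have h2 : 1 / √s * (s - t) ≤ 2 * √s - 2 * √t := by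
      have h3 := Real.sq_sqrt hs.1.le
      have h4 := Real.sq_sqrt ht.1
      have h5 := Real.sqrt_pos.2 hs.1
      have h6 := Real.sqrt_le_sqrt ht.2
      rw [one_div, inv_mul_le_iff₀ h5]
      nlinarith [sq_nonneg (√s - √t)]
    linarith
  · intro x v e δ D C₀ C₁ hx hv hC₀ hC₁ hD hvD he hδ hδ0 he0 heη
    have hs0 := Real.sqrt_pos.2 he0
    have hd0 := (hpos _ (hhalf e ⟨he0, heη⟩)).le
    have hinv : 0 ≤ 1 / √e := by positivity
    have hexp : (deriv φ (e / 2) + 1 / √e) * ((C₀ + C₁) * D) =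
      deriv φ (e / 2) * (C₀ * D) + deriv φ (e / 2) * (C₁ * D) + 1 / √e * (C₀ * D) +
        1 / √e * (C₁ * D) := by ring
    have t1 : 0 ≤ deriv φ (e / 2) * (C₀ * D) := by positivity
    have t2 : 0 ≤ deriv φ (e / 2) * (C₁ * D) := by positivity
    have t3 : 0 ≤ 1 / √e * (C₀ * D) := by positivity
    have t4 : 0 ≤ 1 / √e * (C₁ * D) := by positivity
    rw [hexp]
    rcases le_or_gt (e / 2) ((g x).toReal - (g p).toReal) with hcase | hcase
    · have hxp := EReal.coe_toReal hp' hp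
      have hxx := EReal.coe_toReal hv.2.1 hv.1
      have h1 := hKL x (hrU (by rwa [Metric.mem_ball, dist_eq_norm]))
        (by rw [← hxp, ← hxx, EReal.coe_lt_coe_iff]; linarith)
        (by rw [← hxp, ← hxx, ← EReal.coe_add, EReal.coe_lt_coe_iff]; linarith) v hv
      have hmem : (g x).toReal - (g p).toReal ∈ Ioo 0 η := ⟨by linarith, by linarith⟩
      have h2 := hantit (hhalf e ⟨he0, heη⟩) hmem hcase
      have h3 : 1 ≤ deriv φ (e / 2) * (C₀ * D) :=
        h1.trans (mul_le_mul h2 hvD (norm_nonneg _) hd0)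
      linarith
    · have h1 : √e ≤ C₁ * D := Real.sqrt_le_iff.2 ⟨by positivity, by nlinarith⟩
      have h2 : 1 ≤ 1 / √e * (C₁ * D) := by
        rw [one_div, ← div_eq_inv_mul, one_le_div hs0]; exact h1
      linarith

end

/-! ### Abstract convergence of descent sequences -/

section

variable {n : ℕ} {g : E n → EReal} {c C₀ C₁ C₂ : ℝ} {xm : E n} {x : ℕ → E n} {V : ℕ → ℝ}

/-- Sufficient decrease of an energy `V ≥ g` along `x`, with subgradients of `g` controlled by the
last two steps. -/
structure IsDescentSequence (g : E n → EReal) (c C₀ C₁ C₂ : ℝ) (xm : E n) (x : ℕ → E n)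
    (V : ℕ → ℝ) : Prop where
  ne_top : ∀ k, g (x (k + 1)) ≠ ⊤
  descent : ∀ k, g (x k) ≠ ⊤ → V (k + 1) + c * ‖x k - prev xm x k‖ ^ 2 ≤ V k
  le_energy : ∀ k, (g (x k)).toReal ≤ V k
  energy_le : ∀ k, V k - (g (x k)).toReal ≤ C₁ ^ 2 / 2 * ‖x k - prev xm x k‖ ^ 2
  exists_subgradient : ∀ k, ∃ v, IsProximalSubgradient g C₂ (x (k + 1)) v ∧
    ‖v‖ ≤ C₀ * (‖x (k + 1) - x k‖ + ‖x k - prev xm x k‖)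

theorem le_coe_of_tendsto (hlsc : LowerSemicontinuous g) (hbot : ∀ x, g x ≠ ⊥) {u : ℕ → E n}
    {q : E n} {l : ℝ} (hu : Tendsto u atTop (𝓝 q)) (hfin : ∀ᶠ k in atTop, g (u k) ≠ ⊤)
    (hl : Tendsto (fun k => (g (u k)).toReal) atTop (𝓝 l)) : g q ≤ l := by
  refine le_of_forall_lt fun b hb => ?_
  obtain ⟨b', hbb', hb'⟩ := exists_between hb
  refine hbb'.trans_le ?_
  have h1 : Tendsto (fun k => (((g (u k)).toReal : ℝ) : EReal)) atTop (𝓝 (l : EReal)) :=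
    (continuous_coe_real_ereal.tendsto l).comp hl
  refine ge_of_tendsto h1 ?_
  filter_upwards [hu.eventually (hlsc q b' hb'), hfin] with k hk hk'
  rw [EReal.coe_toReal hk' (hbot _)]
  exact hk.le

theorem Proper.ne_top_of_mem_argmin {p : E n} (hprop : Proper g) (hp : p ∈ argmin g) :
    g p ≠ ⊤ := by
  obtain ⟨u, hu⟩ := hprop.2
  exact fun h => hu (top_le_iff.1 (h ▸ hp u))

namespace IsDescentSequence

theorem ne_top_of_le (h : IsDescentSequence g c C₀ C₁ C₂ xm x V) {m : ℕ} (hm : g (x m) ≠ ⊤)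
    (j : ℕ) : g (x (m + j)) ≠ ⊤ := by
  cases j with
  | zero => exact hm
  | succ j => exact h.ne_top (m + j)

theorem sum_le (h : IsDescentSequence g c C₀ C₁ C₂ xm x V) {m : ℕ} (hm : g (x m) ≠ ⊤) (N : ℕ) :
    V (m + N) + c * ∑ j ∈ Finset.range N, ‖x (m + j) - prev xm x (m + j)‖ ^ 2 ≤ V m := by
  induction N with
  | zero => simp
  | succ N ih =>
    have := h.descent (m + N) (h.ne_top_of_le hm N)
    rw [Finset.sum_range_succ, mul_add, show m + (N + 1) = m + N + 1 from rfl]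
    linarith

theorem summable_sq (h : IsDescentSequence g c C₀ C₁ C₂ xm x V) (hc : 0 < c) {b : ℝ}
    (hb : ∀ u, (b : EReal) ≤ g u) (hbot : ∀ u, g u ≠ ⊥) :
    Summable fun k => ‖x k - prev xm x k‖ ^ 2 := by
  have hm : g (x 1) ≠ ⊤ := h.ne_top 0
  refine (summable_nat_add_iff 1).1 ?_
  refine summable_of_sum_range_le (c := (V 1 - b) / c) (fun k => sq_nonneg _) fun N => ?_
  have h1 := h.sum_le hm N
  have h2 := hb (x (1 + N))
  rw [← EReal.coe_toReal (h.ne_top_of_le hm N) (hbot _), EReal.coe_le_coe_iff] at h2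
  have h3 := h.le_energy (1 + N)
  rw [le_div_iff₀ hc]
  simp only [add_comm 1] at h1 h2 h3
  linarith

theorem tendsto_norm_sub_prev (h : IsDescentSequence g c C₀ C₁ C₂ xm x V) (hc : 0 < c) {b : ℝ}
    (hb : ∀ u, (b : EReal) ≤ g u) (hbot : ∀ u, g u ≠ ⊥) :
    Tendsto (fun k => ‖x k - prev xm x k‖) atTop (𝓝 0) := by
  have h1 := (h.summable_sq hc hb hbot).tendsto_atTop_zero.sqrt
  simpa [Real.sqrt_sq (norm_nonneg _)] using h1

theorem tendsto_toReal (h : IsDescentSequence g c C₀ C₁ C₂ xm x V)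
    (hd : Tendsto (fun k => ‖x k - prev xm x k‖) atTop (𝓝 0)) {l : ℝ}
    (hV : Tendsto V atTop (𝓝 l)) : Tendsto (fun k => (g (x k)).toReal) atTop (𝓝 l) := by
  have h1 : Tendsto (fun k => V k - C₁ ^ 2 / 2 * ‖x k - prev xm x k‖ ^ 2) atTop (𝓝 l) := by
    simpa using hV.sub ((hd.pow 2).const_mul (C₁ ^ 2 / 2))
  refine tendsto_of_tendsto_of_tendsto_of_le_of_le h1 hV (fun k => ?_) h.le_energy
  have := h.energy_le k
  show V k - C₁ ^ 2 / 2 * ‖x k - prev xm x k‖ ^ 2 ≤ _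
  linarith

/-- Convergence from an index at which the iterate is close to a point `p` with the
Kurdyka-Łojasiewicz property and the energy is close to its value. -/
theorem exists_trapping (hbot : ∀ u, g u ≠ ⊥) (hc : 0 < c) (hC₀ : 0 ≤ C₀) (hC₁ : 0 ≤ C₁)
    {p : E n} (hKL : KLAt g p) (hp : g p ≠ ⊤) {r : ℝ} (hr : 0 < r) :
    ∃ u ∈ Ioo 0 r, ∃ μ : ℝ, 0 < μ ∧ ∀ (C₂ : ℝ) (xm : E n) (x : ℕ → E n) (V : ℕ → ℝ),
      IsDescentSequence g c C₀ C₁ C₂ xm x V → ∀ m, g (x m) ≠ ⊤ → ‖x m - p‖ ≤ u →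
      (∀ j, (g p).toReal ≤ V (m + j)) → V m < (g p).toReal + μ →
      (∀ j, ‖x (m + j) - p‖ < r) ∧ (Summable fun k => ‖x k - prev xm x k‖) ∧
        Tendsto V atTop (𝓝 (g p).toReal) ∧ ∃ q, Tendsto x atTop (𝓝 q) ∧ ‖q - p‖ < r := by
  obtain ⟨r₀, hr₀, η, hη, φ, φ', hφ, hkl⟩ := hKL.exists_desingularizer (hbot p) hp
  set ρ := min (r / 2) r₀ with hρ
  have hρ0 : 0 < ρ := lt_min (half_pos hr) hr₀
  have hρr : ρ ≤ r / 2 := min_le_left _ _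
  obtain ⟨μ, hμ, hμη, hsmall⟩ := hφ.exists_small hη c ((C₀ + C₁) / c) (half_pos hρ0)
  -- The start uses `ρ / 4` and the length bound `ρ / 2`, so the iterates stay within `ρ`. Since `ρ
  -- ≤ r / 2`, the limit is still strictly within `r`.
  refine ⟨ρ / 4, ⟨by positivity, by linarith⟩, μ, hμ, fun C₂ xm x V h m hm hxm hV hVm => ?_⟩
  have htrap := kl_trapping (x := fun j => x (m + j)) (p := p)
    (d := fun j => ‖x (m + j) - prev xm x (m + j)‖) (e := fun j => V (m + j) - (g p).toReal)
    (C := C₀ + C₁) (r := ρ) hφ hc (add_nonneg hC₀ hC₁) (norm_nonneg _) (fun k => rfl)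
    (fun k => sub_nonneg.2 (hV k))
    (fun k => by
      have := h.descent (m + k) (h.ne_top_of_le hm k)
      rw [show m + (k + 1) = m + k + 1 from rfl]
      linarith)
    (by rw [add_zero]; linarith)
    (fun k hk he heη => by
      obtain ⟨v, hv, hvn⟩ := h.exists_subgradient (m + k)
      have hfin := h.ne_top (m + k)
      refine hkl (x (m + k + 1)) v _ (V (m + k + 1) - (g (x (m + k + 1))).toReal)
        (‖x (m + k + 1) - x (m + k)‖ + ‖x (m + k) - prev xm x (m + k)‖) C₀ C₁
        (hk.trans_le (min_le_right _ _))
        (regularSubdiff_subset_limitingSubdiff (hv.mem_regularSubdiff (hbot _) hfin)) hC₀ hC₁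
        (by positivity) hvn ?_ ((h.energy_le _).trans ?_) (sub_nonneg.2 (h.le_energy _)) he heη
      · rw [show m + (k + 1) = m + k + 1 from rfl]; ring
      · have h1 : ‖x (m + k + 1) - prev xm x (m + k + 1)‖ ≤
            ‖x (m + k + 1) - x (m + k)‖ + ‖x (m + k) - prev xm x (m + k)‖ :=
          le_add_of_nonneg_right (norm_nonneg _)
        gcongr)
    (by
      simp only [add_zero]
      have := hsmall (V m - (g p).toReal) (by have := hV 0; rw [add_zero] at this; linarith)
        (by linarith)
      linarith)
  obtain ⟨h1, h2, h3⟩ := htrap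
  have hsum : Summable fun k => ‖x k - prev xm x k‖ := by
    refine (summable_nat_add_iff m).1 ?_
    simpa only [add_comm m] using h2
  have hcauchy : CauchySeq x := by
    refine cauchySeq_of_summable_dist ?_
    have h4 := (summable_nat_add_iff 1).2 hsum
    simpa only [dist_eq_norm', prev] using h4
  obtain ⟨q, hq⟩ := cauchySeq_tendsto_of_complete hcauchy
  refine ⟨fun j => (h1 j).trans_le (by linarith), hsum, ?_, q, hq, ?_⟩
  · have h5 := h3.add_const (g p).toReal
    simp only [sub_add_cancel, zero_add] at h5
    rw [← tendsto_add_atTop_iff_nat m]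
    simpa only [add_comm m] using h5
  · have h6 : Tendsto (fun j => ‖x (m + j) - p‖) atTop (𝓝 ‖q - p‖) := by
      have h7 := (tendsto_add_atTop_iff_nat m).2 hq
      simp only [add_comm _ m] at h7
      exact (h7.sub_const p).norm
    have := le_of_tendsto' h6 fun j => (h1 j).le
    linarith

/-- A bounded descent sequence of a Kurdyka-Łojasiewicz function has finite length and converges
to a critical point. -/
theorem exists_tendsto_crit (h : IsDescentSequence g c C₀ C₁ C₂ xm x V) (hc : 0 < c)
    (hC₀ : 0 ≤ C₀) (hC₁ : 0 ≤ C₁) (hlsc : LowerSemicontinuous g) (hbot : ∀ u, g u ≠ ⊥) {b : ℝ}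
    (hb : ∀ u, (b : EReal) ≤ g u) (hKL : IsKL g) (hx : Bornology.IsBounded (range x)) :
    (Summable fun k => ‖x k - prev xm x k‖) ∧ ∃ p ∈ crit g, Tendsto x atTop (𝓝 p) := by
  have hd := h.tendsto_norm_sub_prev hc hb hbot
  have hanti : Antitone fun k => V (k + 1) := antitone_nat_of_succ_le fun k => by
    have := h.descent (k + 1) (h.ne_top k)
    have : 0 ≤ c * ‖x (k + 1) - prev xm x (k + 1)‖ ^ 2 := by positivity
    linarith
  have hbV : ∀ k, b ≤ V (k + 1) := fun k => by
    have h2 := hb (x (k + 1))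
    rw [← EReal.coe_toReal (h.ne_top k) (hbot _), EReal.coe_le_coe_iff] at h2
    exact h2.trans (h.le_energy _)
  have hbdd : BddBelow (range fun k => V (k + 1)) := ⟨b, by rintro _ ⟨k, rfl⟩; exact hbV k⟩
  have hlim := tendsto_atTop_ciInf hanti hbdd
  have hle := fun k => ciInf_le hbdd k
  set l := ⨅ k, V (k + 1)
  have hV : Tendsto V atTop (𝓝 l) := (tendsto_add_atTop_iff_nat 1).1 hlim
  have hg := h.tendsto_toReal hd hV
  obtain ⟨p, -, s, hs, hsp⟩ := tendsto_subseq_of_bounded hx fun k => mem_range_self (f := x) (k + 1)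
  have hs1 : Tendsto (fun j => s j + 1) atTop atTop :=
    (tendsto_add_atTop_nat 1).comp hs.tendsto_atTop
  have hsg := hg.comp hs1
  have hpl : g p ≤ l :=
    le_coe_of_tendsto hlsc hbot hsp (Eventually.of_forall fun j => h.ne_top (s j)) hsg
  have hp : g p ≠ ⊤ := (hpl.trans_lt (EReal.coe_lt_top l)).ne
  choose v hv hvn using h.exists_subgradient
  have hv0 : Tendsto v atTop (𝓝 0) := by
    rw [tendsto_zero_iff_norm_tendsto_zero]
    have h3 : Tendsto (fun k => C₀ * (‖x (k + 1) - x k‖ + ‖x k - prev xm x k‖)) atTop (𝓝 0) := by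
      have h4 := (((tendsto_add_atTop_iff_nat 1).2 hd).add hd).const_mul C₀
      simpa only [prev, add_zero, mul_zero] using h4
    exact squeeze_zero (fun k => norm_nonneg _) hvn h3
  have hvs := hv0.comp hs.tendsto_atTop
  -- Lower semicontinuity gives `≤`. Conversely, the proximal inequality at the iterates is tested
  -- at the cluster point `p`, where the correction terms vanish in the limit.
  have hgp : (g p).toReal = l := by
    refine le_antisymm ?_ ?_
    · rwa [← EReal.coe_toReal hp (hbot p), EReal.coe_le_coe_iff] at hpl
    · have h5 : Tendsto (fun j => (g (x (s j + 1))).toReal + (inner ℝ (v (s j)) (p - x (s j + 1)) -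
          C₂ * ‖p - x (s j + 1)‖ ^ 2)) atTop (𝓝 l) := by
        have h6 : Tendsto (fun j => p - x (s j + 1)) atTop (𝓝 (p - p)) := hsp.const_sub p
        have h7 := hsg.add ((hvs.inner h6).sub ((h6.norm.pow 2).const_mul C₂))
        simpa using h7
      refine le_of_tendsto' h5 fun j => ?_
      have h8 := hv (s j) p
      rwa [← EReal.coe_toReal (h.ne_top (s j)) (hbot _), ← EReal.coe_toReal hp (hbot p),
        ← EReal.coe_add, EReal.coe_le_coe_iff] at h8
  obtain ⟨u, hu, μ, hμ, htrap⟩ := exists_trapping hbot hc hC₀ hC₁ (hKL p hp) hp one_pos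
  have hxp : Tendsto (fun j => ‖x (s j + 1) - p‖) atTop (𝓝 0) := by
    rw [← tendsto_iff_norm_sub_tendsto_zero]; exact hsp
  have hVs := hV.comp hs1
  obtain ⟨j, hj1, hj2⟩ := ((hxp.eventually_lt_const hu.1).and
    (hVs.eventually_lt_const (lt_add_of_pos_right l hμ))).exists
  obtain ⟨-, h10, -, q, hq, -⟩ := htrap C₂ xm x V h (s j + 1) (h.ne_top _) hj1.le
    (fun i => by
      rw [hgp, show s j + 1 + i = s j + i + 1 by ring]; exact hle (s j + i)) (by rw [hgp]; exact hj2)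
  -- Trapping around `p` makes the whole sequence converge, necessarily to its cluster point.
  obtain rfl : q = p := tendsto_nhds_unique (hq.comp hs1) hsp
  refine ⟨h10, q, ?_, hq⟩
  refine ⟨hbot q, hp, fun j => x (s j + 1), fun j => v (s j), hsp, ?_,
    fun j => (hv (s j)).mem_regularSubdiff (hbot _) (h.ne_top _), hvs⟩
  have h11 : Tendsto (fun j => (((g (x (s j + 1))).toReal : ℝ) : EReal)) atTop
      (𝓝 (((g q).toReal : ℝ) : EReal)) := by
    rw [hgp]; exact (continuous_coe_real_ereal.tendsto l).comp hsg
  rw [EReal.coe_toReal hp (hbot q)] at h11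
  exact h11.congr fun j => EReal.coe_toReal (h.ne_top (s j)) (hbot _)

end IsDescentSequence

/-- Descent sequences started near a global minimizer, with almost minimal energy, stay near it
and converge to a global minimizer. -/
theorem exists_tendsto_argmin (hc : 0 < c) (hC₀ : 0 ≤ C₀) (hC₁ : 0 ≤ C₁)
    (hlsc : LowerSemicontinuous g) (hprop : Proper g) (hKL : IsKL g) {p : E n}
    (hp : p ∈ argmin g) {r : ℝ} (hr : 0 < r) :
    ∃ u ∈ Ioo 0 r, ∃ μ : ℝ, 0 < μ ∧ ∀ (C₂ : ℝ) (x : ℕ → E n) (V : ℕ → ℝ),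
      IsDescentSequence g c C₀ C₁ C₂ (x 0) x V → ‖x 0 - p‖ ≤ u → g (x 0) < g p + (μ : EReal) →
      (∀ k, ‖x k - p‖ < r) ∧ (Summable fun k => ‖x k - prev (x 0) x k‖) ∧
        ∃ q ∈ argmin g, ‖q - p‖ < r ∧ Tendsto x atTop (𝓝 q) := by
  have hbot := hprop.1
  have hpt : g p ≠ ⊤ := hprop.ne_top_of_mem_argmin hp
  have hpc := EReal.coe_toReal hpt (hbot p)
  obtain ⟨u, hu, μ, hμ, htrap⟩ :=
    IsDescentSequence.exists_trapping hbot hc hC₀ hC₁ (hKL p hpt) hpt hr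
  refine ⟨u, hu, μ, hμ, fun C₂ x V h hxu hgx => ?_⟩
  have h0 : g (x 0) ≠ ⊤ := ne_top_of_lt hgx
  have hfin : ∀ k, g (x k) ≠ ⊤ := fun k => by
    have := h.ne_top_of_le h0 k
    rwa [zero_add] at this
  -- The choice `xm = x 0` makes the first step vanish, so `energy_le` bounds the initial energy by
  -- the objective value.
  have hV0 : V 0 < (g p).toReal + μ := by
    have h1 := h.energy_le 0
    rw [← hpc, ← EReal.coe_toReal h0 (hbot _), ← EReal.coe_add, EReal.coe_lt_coe_iff] at hgx
    simp only [prev, sub_self, norm_zero] at h1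
    linarith
  have hVp : ∀ k, (g p).toReal ≤ V k := fun k => by
    have h1 := hp (x k)
    rw [← hpc, ← EReal.coe_toReal (hfin k) (hbot _), EReal.coe_le_coe_iff] at h1
    exact h1.trans (h.le_energy k)
  obtain ⟨h2, h3, h4, q, hq, hqp⟩ := htrap C₂ (x 0) x V h 0 h0 hxu (fun j => hVp _) hV0
  refine ⟨fun k => by simpa using h2 k, h3, q, fun w => ?_, hqp, hq⟩
  have h5 := le_coe_of_tendsto hlsc hbot hq (Eventually.of_forall hfin)
    (h.tendsto_toReal h3.tendsto_atTop_zero h4)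
  rw [hpc] at h5
  exact h5.trans (hp w)

end

/-! ### The algorithm as a descent sequence -/

section

/-- The shifted parameters `k ↦ a (k - 1)`, with first term `1`. -/
def prevParam (a : ℕ → ℝ) : ℕ → ℝ
  | 0 => 1
  | k + 1 => a k

/-- The energy that decreases along the algorithm. -/
noncomputable def energy {n : ℕ} (F : E n → ℝ) (G : E n → EReal) (T : E n →L[ℝ] E n)
    (L κ ν : ℝ) (a : ℕ → ℝ) (xm : E n) (x : ℕ → E n) (k : ℕ) : ℝ :=
  (objective F G (x k)).toReal + L / 2 * ((prevParam a k ^ (1 - κ) + ν * (1 - prevParam a k)) *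
    inner ℝ (T (x k - prev xm x k)) (x k - prev xm x k))

namespace Parameters

variable {κ lo hi : ℝ} {a : ℕ → ℝ}

theorem lo_le_one (h : Parameters κ lo hi a) : lo ≤ 1 := h.lo_lt_hi.le.trans h.hi_le_one

theorem mem_Icc (h : Parameters κ lo hi a) (k : ℕ) : a k ∈ Icc lo 1 := by
  cases k with
  | zero => rw [h.a_zero]; exact ⟨h.lo_le_one, le_rfl⟩
  | succ k => exact ⟨(h.a_mem k).1, (h.a_mem k).2.trans h.hi_le_one⟩

theorem prevParam_mem_Icc (h : Parameters κ lo hi a) (k : ℕ) : prevParam a k ∈ Icc lo 1 := by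
  cases k with
  | zero => exact ⟨h.lo_le_one, le_rfl⟩
  | succ k => exact h.mem_Icc k

theorem step_prevParam (h : Parameters κ lo hi a) (k : ℕ) (hk : prevParam a k < 1) :
    (a k ^ (1 - κ) + 1) ^ (1 / κ) * (1 - a k) <
      prevParam a k ^ (1 / κ - 1) / (1 - prevParam a k) := by
  cases k with
  | zero => exact absurd hk (lt_irrefl _)
  | succ k => exact h.a_step k hk

theorem extrapolation_mem_Icc (h : Parameters κ lo hi a) (k : ℕ) :
    (1 - a k) * (1 - prevParam a k) ∈ Icc (0 : ℝ) 1 := by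
  have h1 := h.mem_Icc k
  have h2 := h.prevParam_mem_Icc k
  have := h.lo_pos
  exact ⟨mul_nonneg (by linarith [h1.2]) (by linarith [h2.2]),
    mul_le_one₀ (by linarith [h1.1]) (by linarith [h2.2]) (by linarith [h2.1])⟩

theorem rpow_le (h : Parameters κ lo hi a) {b : ℝ} (hb : b ∈ Icc lo 1) :
    b ^ (1 - κ) ≤ lo ^ (1 - κ) :=
  Real.rpow_le_rpow_of_nonpos h.lo_pos hb.1 (by linarith [h.one_lt_κ])

theorem rpow_pos (h : Parameters κ lo hi a) {b : ℝ} (hb : b ∈ Icc lo 1) : 0 < b ^ (1 - κ) :=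
  Real.rpow_pos_of_pos (h.lo_pos.trans_le hb.1) _

end Parameters

variable {n : ℕ} {F ψ : E n → ℝ} {G : E n → EReal} {σ L κ lo hi : ℝ} {a : ℕ → ℝ}
  {T : E n →L[ℝ] E n} {x y z : ℕ → E n}

/-- Eliminates `z`. At `k = 0` the convention `prevParam a 0 = 1` makes the factor zero, so `xm` may
be arbitrary. -/
theorem IsIBPG.y_eq (h : IsIBPG F G ψ L κ a x y z) (xm : E n) (k : ℕ) :
    y k = x k - ((1 - a k) * (1 - prevParam a k)) • (x k - prev xm x k) := by
  rw [h.y_step]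
  cases k with
  | zero => simp [h.z_zero, prevParam]
  | succ k => rw [h.z_step]; simp only [prevParam, prev]; module

theorem toReal_objective (hG : Proper G) {u : E n} (hu : G u ≠ ⊤) :
    (objective F G u).toReal = F u + (G u).toReal := by
  rw [objective_eq_coe hG u hu, EReal.toReal_coe]

theorem objective_lowerSemicontinuous (hA : PremiseA F G) :
    LowerSemicontinuous (objective F G) := by
  have h1 : LowerSemicontinuous fun x => (F x : EReal) :=
    (continuous_coe_real_ereal.comp hA.smooth.continuous).lowerSemicontinuous
  exact h1.add' hA.closed fun x => EReal.continuousAt_add (Or.inl (EReal.coe_ne_top _))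
    (Or.inl (EReal.coe_ne_bot _))

theorem objective_proper (hA : PremiseA F G) : Proper (objective F G) := by
  refine ⟨fun x hx => ?_, ?_⟩
  · obtain ⟨m, hm⟩ := hA.bddBelow
    have := hm x
    rw [hx, le_bot_iff] at this
    exact EReal.coe_ne_bot m this
  · obtain ⟨u, hu⟩ := hA.proper.2
    exact ⟨u, objective_ne_top_iff.2 hu⟩

namespace IsIBPG

theorem energy_descent (h : IsIBPG F G ψ L κ a x y z) (ha : Parameters κ lo hi a)
    (hG : Proper G) (hF : RelSmooth F ψ L) (hσ : 0 < σ) (hT : IsQuadraticKernel ψ σ T)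
    {ν δ : ℝ} (hc : IsLyapunovPair κ lo ν δ)
    (xm : E n) (k : ℕ) (hk : G (x k) ≠ ⊤) :
    energy F G T L κ ν a xm x (k + 1) +
      L / 2 * (δ * inner ℝ (T (x k - prev xm x k)) (x k - prev xm x k)) ≤
        energy F G T L κ ν a xm x k := by
  have hL := hF.1
  obtain ⟨s, hs, hstep⟩ := h.x_step k
  have hak := ha.mem_Icc k
  have hsp := eq_of_prox_step hT hL (ha.lo_pos.trans_le hak.1) hstep
  rw [h.y_eq xm k] at hsp
  obtain ⟨h1, h2⟩ := hc.bounds _ hak _ (ha.prevParam_mem_Icc k) (ha.step_prevParam k)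
  set θ := (1 - a k) * (1 - prevParam a k) with hθ
  set w := x k - prev xm x k with hw
  obtain ⟨w', hw'⟩ : ∃ w', x (k + 1) = x k + w' := ⟨x (k + 1) - x k, by abel⟩
  rw [hw'] at hs hsp
  have hdesc := objective_descent hT hF hG hs hk hsp
  -- Young's inequality with `ε = lo` splits the surplus `ν (1 - a k) Q w'` into a part in `Q (w' +
  -- θ w)`, absorbed by the term with `p - 1`, and a part in `Q w`. The weights match
  -- `IsLyapunovPair.bounds`.
  have hyoung := hT.young hσ.le ha.lo_pos θ w' w
  have hQs := hT.nonneg hσ.le (w' + θ • w)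
  have hQw := hT.nonneg hσ.le w
  have e1 : x (k + 1) - prev xm x (k + 1) = w' := by
    show x (k + 1) - x k = w'
    rw [hw']; abel
  have hfin := hG.ne_top_of_mem_convexSubdiff hs
  simp only [energy, e1, ← hw]
  rw [hw', toReal_objective hG hfin, toReal_objective hG hk]
  show F (x k + w') + (G (x k + w')).toReal + L / 2 * ((a k ^ (1 - κ) + ν * (1 - a k)) * _) + _ ≤ _
  set p := a k ^ (1 - κ)
  set q := prevParam a k ^ (1 - κ)
  set A := inner ℝ (T w) w
  set B := inner ℝ (T w') w'
  set S := inner ℝ (T (w' + θ • w)) (w' + θ • w)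
  have hνa : 0 ≤ ν * (1 - a k) := mul_nonneg hc.nonneg (by linarith [hak.2])
  have h3 := mul_le_mul_of_nonneg_left hyoung hνa
  have h4 := mul_le_mul_of_nonneg_right h1 hQs
  have h5 := mul_le_mul_of_nonneg_right h2 hQw
  have h6 : (p + 1) * θ ^ 2 * A - p * B - (p - 1) * S + (p + ν * (1 - a k)) * B + δ * A ≤
      (q + ν * (1 - prevParam a k)) * A := by linarith
  have h7 := mul_le_mul_of_nonneg_left h6 (by positivity : 0 ≤ L / 2)
  linarith

theorem exists_subgradient (h : IsIBPG F G ψ L κ a x y z) (ha : Parameters κ lo hi a)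
    (hG : Proper G) (hF : RelSmooth F ψ L) (hT : IsQuadraticKernel ψ σ T) (xm : E n) (k : ℕ) :
    ∃ v, IsProximalSubgradient (objective F G) (L / 2 * ‖T‖) (x (k + 1)) v ∧
      ‖v‖ ≤ (L * lo ^ (1 - κ) * ‖T‖ + 3 * L * ‖T‖) *
        (‖x (k + 1) - x k‖ + ‖x k - prev xm x k‖) := by
  have hL := hF.1
  obtain ⟨s, hs, hstep⟩ := h.x_step k
  have hak := ha.mem_Icc k
  refine ⟨_, isProximalSubgradient_objective hT hF hG hs, ?_⟩
  have hsp := eq_of_prox_step hT hL (ha.lo_pos.trans_le hak.1) hstep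
  have hp0 := ha.rpow_pos hak
  have hlo0 := Real.rpow_pos_of_pos ha.lo_pos (1 - κ)
  have hθ := ha.extrapolation_mem_Icc k
  have hxy : ‖x (k + 1) - y k‖ ≤ ‖x (k + 1) - x k‖ + ‖x k - prev xm x k‖ := by
    rw [h.y_eq xm k, sub_sub_eq_add_sub, add_sub_right_comm]
    refine (norm_add_le _ _).trans (add_le_add_right ?_ _)
    rw [norm_smul, Real.norm_of_nonneg hθ.1]
    exact mul_le_of_le_one_left (norm_nonneg _) hθ.2
  have h1 : ‖(L * a k ^ (1 - κ)) • T (y k - x (k + 1))‖ ≤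
      L * lo ^ (1 - κ) * ‖T‖ * ‖x (k + 1) - y k‖ := by
    rw [norm_smul, Real.norm_of_nonneg (by positivity), norm_sub_rev (x (k + 1)), mul_assoc _ ‖T‖]
    exact mul_le_mul (mul_le_mul_of_nonneg_left (ha.rpow_le hak) hL.le) (T.le_opNorm _)
      (norm_nonneg _) (by positivity)
  have h2 := hT.norm_gradient_sub_le hF (x (k + 1)) (y k)
  -- The subgradient of the objective is controlled by `x (k + 1) - y k` alone, hence by the last
  -- two steps.
  have h3 : s + gradient F (x (k + 1)) = (L * a k ^ (1 - κ)) • T (y k - x (k + 1)) +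
      (gradient F (x (k + 1)) - gradient F (y k)) := by rw [hsp]; abel
  rw [h3]
  refine (norm_add_le _ _).trans ((add_le_add h1 h2).trans ?_)
  rw [← add_mul]
  gcongr

theorem isDescentSequence (h : IsIBPG F G ψ L κ a x y z) (ha : Parameters κ lo hi a)
    (hG : Proper G) (hF : RelSmooth F ψ L) (hσ : 0 < σ) (hT : IsQuadraticKernel ψ σ T)
    {ν δ : ℝ} (hc : IsLyapunovPair κ lo ν δ)
    (xm : E n) :
    IsDescentSequence (objective F G) (L / 2 * (δ * σ)) (L * lo ^ (1 - κ) * ‖T‖ + 3 * L * ‖T‖)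
      √(L * (lo ^ (1 - κ) + ν) * ‖T‖) (L / 2 * ‖T‖) xm x (energy F G T L κ ν a xm x) := by
  have hL := hF.1
  refine ⟨fun k => ?_, fun k hk => ?_, fun k => ?_, fun k => ?_,
    fun k => h.exists_subgradient ha hG hF hT xm k⟩
  · obtain ⟨s, hs, -⟩ := h.x_step k
    exact objective_ne_top_iff.2 (hG.ne_top_of_mem_convexSubdiff hs)
  · have h1 := h.energy_descent ha hG hF hσ hT hc xm k (objective_ne_top_iff.1 hk)
    have h2 := mul_le_mul_of_nonneg_left (hT.lower (x k - prev xm x k))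
      (mul_nonneg (by positivity : 0 ≤ L / 2) hc.pos.le)
    linarith
  · have h1 := ha.prevParam_mem_Icc k
    have h2 := ha.rpow_pos h1
    have h3 := hT.nonneg hσ.le (x k - prev xm x k)
    have h4 := mul_nonneg hc.nonneg (sub_nonneg.2 h1.2)
    exact le_add_of_nonneg_right (by positivity)
  · have h1 := ha.prevParam_mem_Icc k
    have h2 := ha.rpow_pos h1
    have h3 := Real.rpow_pos_of_pos ha.lo_pos (1 - κ)
    have h4 := mul_nonneg hc.nonneg (sub_nonneg.2 h1.2)
    have h5 : prevParam a k ^ (1 - κ) + ν * (1 - prevParam a k) ≤ lo ^ (1 - κ) + ν :=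
      add_le_add (ha.rpow_le h1) (mul_le_of_le_one_right hc.nonneg
        (by linarith [h1.1, ha.lo_pos]))
    have hν := hc.nonneg
    rw [Real.sq_sqrt (by positivity), energy, add_sub_cancel_left]
    have h6 := mul_le_mul_of_nonneg_left (mul_le_mul h5
      (IsQuadraticKernel.inner_le T (x k - prev xm x k)) (hT.nonneg hσ.le _) (by positivity))
      (by positivity : 0 ≤ L / 2)
    linarith

/-- The inertial sequences inherit finite length and limits from the main sequence. -/
theorem finiteLength (h : IsIBPG F G ψ L κ a x y z) (ha : Parameters κ lo hi a)
    (hsum : Summable fun k => ‖x k - prev (x 0) x k‖) :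
    FiniteLength x ∧ FiniteLength y ∧ FiniteLength z := by
  have h1 : Summable fun k => ‖x (k + 1) - x k‖ :=
    (summable_nat_add_iff (f := fun k => ‖x k - prev (x 0) x k‖) 1).2 hsum
  have h2 : Summable fun k => ‖x (k + 1 + 1) - x (k + 1)‖ :=
    (summable_nat_add_iff (f := fun k => ‖x (k + 1) - x k‖) 1).2 h1
  have hy : ∀ k, ‖y (k + 1) - y k‖ ≤ ‖x (k + 1) - x k‖ + ‖x k - prev (x 0) x k‖ := by
    intro k
    have hs := ha.extrapolation_mem_Icc k
    have ht := ha.extrapolation_mem_Icc (k + 1)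
    have e : y (k + 1) - y k =
        (1 - (1 - a (k + 1)) * (1 - prevParam a (k + 1))) • (x (k + 1) - x k) +
          ((1 - a k) * (1 - prevParam a k)) • (x k - prev (x 0) x k) := by
      rw [h.y_eq (x 0) k, h.y_eq (x 0) (k + 1)]
      simp only [prev]
      module
    rw [e]
    refine (norm_add_le _ _).trans ?_
    rw [norm_smul, norm_smul, Real.norm_of_nonneg hs.1, Real.norm_of_nonneg (sub_nonneg.2 ht.2)]
    exact add_le_add (mul_le_of_le_one_left (norm_nonneg _) (by linarith [ht.1]))
      (mul_le_of_le_one_left (norm_nonneg _) hs.2)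
  have hz : ∀ k, ‖z (k + 1 + 1) - z (k + 1)‖ ≤
      ‖x (k + 1) - x k‖ + ‖x (k + 1 + 1) - x (k + 1)‖ := by
    intro k
    have hs := ha.mem_Icc k
    have ht := ha.mem_Icc (k + 1)
    have := ha.lo_pos
    have e : z (k + 1 + 1) - z (k + 1) =
        (1 - a k) • (x (k + 1) - x k) + a (k + 1) • (x (k + 1 + 1) - x (k + 1)) := by
      rw [h.z_step, h.z_step]
      module
    rw [e]
    refine (norm_add_le _ _).trans ?_
    rw [norm_smul, norm_smul, Real.norm_of_nonneg (sub_nonneg.2 hs.2),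
      Real.norm_of_nonneg (by linarith [ht.1])]
    exact add_le_add (mul_le_of_le_one_left (norm_nonneg _) (by linarith [hs.1]))
      (mul_le_of_le_one_left (norm_nonneg _) ht.2)
  exact ⟨h1, (h1.add hsum).of_nonneg_of_le (fun k => norm_nonneg _) hy,
    (summable_nat_add_iff (f := fun k => ‖z (k + 1) - z k‖) 1).1
      ((h1.add h2).of_nonneg_of_le (fun k => norm_nonneg _) hz)⟩

theorem convergeTo (h : IsIBPG F G ψ L κ a x y z) (ha : Parameters κ lo hi a)
    (hsum : Summable fun k => ‖x k - prev (x 0) x k‖) {p : E n} (hx : Tendsto x atTop (𝓝 p)) :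
    ConvergeTo x y z p := by
  have hd := hsum.tendsto_atTop_zero
  refine ⟨hx, ?_, ?_⟩
  · have h1 : Tendsto (fun k => y k - x k) atTop (𝓝 0) := by
      refine squeeze_zero_norm (fun k => ?_) hd
      have hs := ha.extrapolation_mem_Icc k
      rw [h.y_eq (x 0) k, sub_sub_cancel_left, norm_neg, norm_smul,
        Real.norm_of_nonneg hs.1]
      exact mul_le_of_le_one_left (norm_nonneg _) hs.2
    simpa using h1.add hx
  · rw [← tendsto_add_atTop_iff_nat 1]
    have h1 : Tendsto (fun k => z (k + 1) - x k) atTop (𝓝 0) := by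
      refine squeeze_zero_norm (fun k => ?_) ((tendsto_add_atTop_iff_nat 1).2 hd)
      have hs := ha.mem_Icc k
      rw [h.z_step, add_sub_cancel_left, norm_smul,
        Real.norm_of_nonneg (ha.lo_pos.le.trans hs.1)]
      exact mul_le_of_le_one_left (norm_nonneg _) hs.2
    simpa using h1.add hx

end IsIBPG

/-- The rate of the smallest step of a descent sequence. -/
theorem IsDescentSequence.inf_sq_le {g : E n → EReal} {c C₀ C₁ C₂ : ℝ} {xm : E n} {x : ℕ → E n}
    {V : ℕ → ℝ} (h : IsDescentSequence g c C₀ C₁ C₂ xm x V) (hc : 0 < c) {b : ℝ}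
    (hb : ∀ u, (b : EReal) ≤ g u) (hbot : ∀ u, g u ≠ ⊥) (h0 : g (x 0) ≠ ⊤) (k : ℕ) :
    (Finset.range (k + 1)).inf' Finset.nonempty_range_add_one
      (fun i => ‖x i - prev xm x i‖ ^ 2) ≤ c⁻¹ / (k + 1) * (V 0 - b) := by
  set s := (Finset.range (k + 1)).inf' Finset.nonempty_range_add_one
    (fun i => ‖x i - prev xm x i‖ ^ 2)
  have h1 := h.sum_le h0 (k + 1)
  simp only [zero_add] at h1
  have h2 : ((k : ℝ) + 1) * s ≤ ∑ j ∈ Finset.range (k + 1), ‖x j - prev xm x j‖ ^ 2 := by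
    have h3 := Finset.card_nsmul_le_sum (Finset.range (k + 1))
      (fun i => ‖x i - prev xm x i‖ ^ 2) s fun i hi => Finset.inf'_le _ hi
    rwa [Finset.card_range, nsmul_eq_mul, Nat.cast_add, Nat.cast_one] at h3
  have h4 := hb (x (k + 1))
  rw [← EReal.coe_toReal (h.ne_top k) (hbot _), EReal.coe_le_coe_iff] at h4
  have h5 := h.le_energy (k + 1)
  have h6 := mul_le_mul_of_nonneg_left h2 hc.le
  have hk : (0 : ℝ) < k + 1 := by positivity
  have h7 : c⁻¹ / (k + 1) * (V 0 - b) = (V 0 - b) / (c * (k + 1)) := by field_simp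
  rw [h7, le_div_iff₀ (by positivity)]
  linarith

end

/-! ### The rate of the smallest step -/

section

variable {n : ℕ} {F ψ : E n → ℝ} {G : E n → EReal} {σ L κ lo hi ν δ : ℝ} {a : ℕ → ℝ}
  {T : E n →L[ℝ] E n} {xm : E n} {x : ℕ → E n}

theorem min_step_sq_le_lyapunov (hA : PremiseA F G) (hL : 0 < L) (hσ : 0 < σ) (hδ : 0 < δ)
    (hT : IsQuadraticKernel ψ σ T) {C₀ C₁ C₂ : ℝ}
    (h : IsDescentSequence (objective F G) (L / 2 * (δ * σ)) C₀ C₁ C₂ xm x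
      (energy F G T L κ ν a xm x)) (k : ℕ) :
    (((Finset.range (k + 1)).inf' Finset.nonempty_range_add_one
      (fun i => ‖x i - prev xm x i‖ ^ 2) : ℝ) : EReal) ≤
        ((2 * (σ * δ * L)⁻¹ / ((k : ℝ) + 1) : ℝ) : EReal) * lyapunov F G ψ L κ 1 (x 0) xm := by
  have hprop := objective_proper hA
  obtain ⟨m, hm⟩ := hA.bddBelow
  have hIbot : (⨅ u, objective F G u) ≠ ⊥ := fun hI => by
    have := le_iInf hm
    rw [hI, le_bot_iff] at this
    exact EReal.coe_ne_bot m this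
  have hItop : (⨅ u, objective F G u) ≠ ⊤ := by
    obtain ⟨u, hu⟩ := hprop.2
    exact ne_top_of_le_ne_top hu (iInf_le _ u)
  have hI := EReal.coe_toReal hItop hIbot
  have hle : ∀ u, (((⨅ u, objective F G u).toReal : ℝ) : EReal) ≤ objective F G u := fun u => by
    rw [hI]; exact iInf_le _ u
  set I := (⨅ u, objective F G u).toReal
  have hcoef : 0 < 2 * (σ * δ * L)⁻¹ / ((k : ℝ) + 1) := by positivity
  rw [lyapunov, ← hI]
  rcases eq_or_ne (objective F G (x 0)) ⊤ with h0 | h0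
  · rw [h0, EReal.top_sub_coe, EReal.top_add_coe, EReal.coe_mul_top_of_pos hcoef]
    exact le_top
  · have h1 := h.inf_sq_le (by positivity) hle hprop.1 h0 k
    rw [← EReal.coe_toReal h0 (hprop.1 _), ← EReal.coe_sub, ← EReal.coe_add, ← EReal.coe_mul,
      EReal.coe_le_coe_iff]
    refine h1.trans (le_of_eq ?_)
    rw [hT.bregman_eq, energy]
    -- At index 0 the surplus `ν (1 - 1)` vanishes, so the energy is the objective plus `L * bregman
    -- ψ (x 0) xm`, as in `lyapunov`.
    simp only [prevParam, prev, Real.one_rpow]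
    field_simp
    ring

end

end IBPG

theorem theorem3p1 (κ lo hi : ℝ) (a : ℕ → ℝ) (ha : IBPG.Parameters κ lo hi a) :
    ∃ ν : ℝ, 0 < ν ∧ ν ≤ 1 ∧
      ∀ (n : ℕ) (F : IBPG.E n → ℝ) (G : IBPG.E n → EReal) (ψ : IBPG.E n → ℝ) (σ L : ℝ),
        IBPG.PremiseA F G → IBPG.PremiseB F ψ σ L → IBPG.TriangleScaling ψ κ →
        -- (i) square summability and rate; `xm` is the point `x_{-1}`, and `a_{-1} = 1`
        (∀ (xm : IBPG.E n) (x y z : ℕ → IBPG.E n), IBPG.IsIBPG F G ψ L κ a x y z →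
          (Summable fun k => ‖x k - IBPG.prev xm x k‖ ^ 2) ∧
          ∀ k : ℕ,
            (((Finset.range (k + 1)).inf' Finset.nonempty_range_add_one
                (fun i => ‖x i - IBPG.prev xm x i‖ ^ 2) : ℝ) : EReal) ≤
              ((2 * (σ * ν * L)⁻¹ / ((k : ℝ) + 1) : ℝ) : EReal) *
                IBPG.lyapunov F G ψ L κ 1 (x 0) xm) ∧
        (IBPG.IsKL (IBPG.objective F G) → IBPG.IsKL (fun u => (ψ u : EReal)) →
          (∃ (K : ℕ) (abar : ℝ), abar ∈ Set.Icc lo hi ∧ ∀ k, K ≤ k → a k = abar) →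
          -- (ii) finite length and convergence to a common critical point
          (∀ x y z : ℕ → IBPG.E n, IBPG.IsIBPG F G ψ L κ a x y z →
            Bornology.IsBounded (Set.range x) →
            IBPG.FiniteLength x ∧ IBPG.FiniteLength y ∧ IBPG.FiniteLength z ∧
            ∃ p ∈ IBPG.crit (IBPG.objective F G), IBPG.ConvergeTo x y z p) ∧
          -- (iii) initialization near a global minimizer in the attentive topology
          (∀ xs ∈ IBPG.argmin (IBPG.objective F G),
            (∀ r : ℝ, 0 < r → ∃ u ∈ Set.Ioo 0 r, ∃ μ : ℝ, 0 < μ ∧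
              ∀ x y z : ℕ → IBPG.E n, IBPG.IsIBPG F G ψ L κ a x y z →
                ‖x 0 - xs‖ ≤ u →
                IBPG.objective F G (x 0) < IBPG.objective F G xs + (μ : EReal) →
                (∀ k, ‖x k - xs‖ < r) ∧
                ∃ p ∈ IBPG.argmin (IBPG.objective F G), ‖p - xs‖ < r ∧
                  IBPG.ConvergeTo x y z p) ∧
            ((∃ ρ : ℝ, 0 < ρ ∧ ∀ p ∈ IBPG.argmin (IBPG.objective F G), ‖p - xs‖ < ρ → p = xs) →
              ∃ u : ℝ, 0 < u ∧ ∃ μ : ℝ, 0 < μ ∧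
                ∀ x y z : ℕ → IBPG.E n, IBPG.IsIBPG F G ψ L κ a x y z →
                  ‖x 0 - xs‖ ≤ u →
                  IBPG.objective F G (x 0) < IBPG.objective F G xs + (μ : EReal) →
                  IBPG.ConvergeTo x y z xs))) := by
  obtain ⟨ν, δ, hc⟩ :=
    IBPG.exists_isLyapunovPair ha.one_lt_κ ha.κ_le_two ha.lo_pos ha.lo_le_one
  -- The constant of the theorem is the decrease factor `δ`, not the Lyapunov surplus `ν`.
  refine ⟨δ, hc.pos, hc.le_one, fun n F G ψ σ L hA hB htri => ?_⟩
  obtain ⟨T, hT⟩ := IBPG.exists_isQuadraticKernel hB htri (by linarith [ha.one_lt_κ])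
  have hF := hB.relSmooth
  have hL := hF.1
  have hσ := hB.σ_pos
  have hδ := hc.pos
  have hν := hc.nonneg
  have hlo := Real.rpow_pos_of_pos ha.lo_pos (1 - κ)
  have hprop := IBPG.objective_proper hA
  have hlsc := IBPG.objective_lowerSemicontinuous hA
  obtain ⟨b, hb⟩ := hA.bddBelow
  have hpos : 0 < L / 2 * (δ * σ) := by positivity
  have hC₀ : 0 ≤ L * lo ^ (1 - κ) * ‖T‖ + 3 * L * ‖T‖ := by positivity
  have hdesc : ∀ (xm : IBPG.E n) (x y z : ℕ → IBPG.E n), IBPG.IsIBPG F G ψ L κ a x y z → _ :=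
    fun xm x y z h => h.isDescentSequence ha hA.proper hF hσ hT hc xm
  refine ⟨fun xm x y z h => ⟨?_, ?_⟩, fun hKL _ _ => ⟨fun x y z h hx => ?_, fun xs hxs => ?_⟩⟩
  · exact (hdesc xm x y z h).summable_sq hpos hb hprop.1
  · exact IBPG.min_step_sq_le_lyapunov hA hL hσ hδ hT (hdesc xm x y z h)
  · obtain ⟨hsum, p, hp, hxp⟩ := (hdesc (x 0) x y z h).exists_tendsto_crit hpos hC₀
      (Real.sqrt_nonneg _) hlsc hprop.1 hb hKL hx
    obtain ⟨h1, h2, h3⟩ := h.finiteLength ha hsum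
    exact ⟨h1, h2, h3, p, hp, h.convergeTo ha hsum hxp⟩
  · have hlocal : ∀ r : ℝ, 0 < r → ∃ u ∈ Set.Ioo 0 r, ∃ μ : ℝ, 0 < μ ∧
        ∀ x y z : ℕ → IBPG.E n, IBPG.IsIBPG F G ψ L κ a x y z → ‖x 0 - xs‖ ≤ u →
          IBPG.objective F G (x 0) < IBPG.objective F G xs + (μ : EReal) →
          (∀ k, ‖x k - xs‖ < r) ∧ ∃ p ∈ IBPG.argmin (IBPG.objective F G), ‖p - xs‖ < r ∧
            IBPG.ConvergeTo x y z p := by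
      intro r hr
      obtain ⟨u, hu, μ, hμ, hmain⟩ := IBPG.exists_tendsto_argmin hpos hC₀
        (Real.sqrt_nonneg (L * (lo ^ (1 - κ) + ν) * ‖T‖)) hlsc hprop hKL hxs hr
      refine ⟨u, hu, μ, hμ, fun x y z h hxu hxμ => ?_⟩
      obtain ⟨h1, hsum, p, hp, hpr, hxp⟩ := hmain _ x _ (hdesc (x 0) x y z h) hxu hxμ
      exact ⟨h1, p, hp, hpr, h.convergeTo ha hsum hxp⟩
    refine ⟨hlocal, fun ⟨ρ, hρ, hiso⟩ => ?_⟩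
    obtain ⟨u, hu, μ, hμ, hmain⟩ := hlocal ρ hρ
    refine ⟨u, hu.1, μ, hμ, fun x y z h hxu hxμ => ?_⟩
    obtain ⟨-, p, hp, hpρ, hconv⟩ := hmain x y z h hxu hxμ
    rwa [hiso p hp hpρ] at hconv
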